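/- Theorem 2. In the house allocation problem there are $n$ agents and $m \ge n$ houses, and each agent $i$ has a nonnegative rational utility $u_i(h)$ for each house $h$, given in binary as a fraction. An outcome $(\mathbf a, \mathbf s)$ consists of pairwise distinct houses $a_1,\dots,a_n$ (agent $i$ receives house $a_i$) and a vector $\mathbf s = (s_1,\dots,s_n)$ of nonnegative real subsidies. It is envy-free if $u_i(a_i) + s_i \ge u_i(a_{i'}) + s_{i'}$ for all agents $i, i'$, and it is a minimum-subsidy envy-free outcome if it is envy-free and $\sum_i s_i \le \sum_i s'_i$ for every envy-free outcome $(\mathbf a', \mathbf s')$. For every constant integer $c \ge 0$, there is an algorithm which, given any such instance with $m = n + c$, computes a minimum-subsidy envy-free outcome (with rational subsidies, output as fractions) in time polynomial in the bit length of the instance. -/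

import Mathlib

namespace HouseAllocation

section Outcomes

/-- An outcome for `n` agents and `m` houses: an allocation of distinct houses to the agents,
together with a nonnegative subsidy vector. -/
structure Outcome (n m : ℕ) where
  house : Fin n ↪ Fin m
  subsidy : Fin n → ℝ
  subsidy_nonneg : ∀ i, 0 ≤ subsidy i

/-- No agent prefers the house and subsidy of another agent to her own, where `u i h` is the
utility of agent `i` for house `h`. -/
def Outcome.IsEnvyFree {n m : ℕ} (u : Fin n → Fin m → ℝ) (o : Outcome n m) : Prop :=
  ∀ i i' : Fin n, u i (o.house i') + o.subsidy i' ≤ u i (o.house i) + o.subsidy i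

/-- An envy-free outcome whose total subsidy is minimum among all envy-free outcomes
(over all allocations and all real nonnegative subsidy vectors). -/
def Outcome.IsMinimumSubsidyEnvyFree {n m : ℕ} (u : Fin n → Fin m → ℝ) (o : Outcome n m) :
    Prop :=
  o.IsEnvyFree u ∧
    ∀ o' : Outcome n m, o'.IsEnvyFree u → ∑ i, o.subsidy i ≤ ∑ i, o'.subsidy i

end Outcomes

section Machine

/-- The memory of a random access machine: arrays, of which a program uses the finitely many that
it names, with cells that are indexed by natural numbers and hold integers of arbitrary size. -/
abbrev Mem : Type := ℕ → ℕ → ℤ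

/-- Overwrite cell `k` of array `a` by `z`. -/
def Mem.set (σ : Mem) (a k : ℕ) (z : ℤ) : Mem :=
  fun a' k' => if a' = a ∧ k' = k then z else σ a' k'

/-- The length of the binary notation of an integer, with one more bit for the sign. -/
def bitSize (z : ℤ) : ℕ := z.natAbs.size + 1

/-- Integer expressions. `load a e` is the content of the cell of array `a` whose index is the
value of `e` (indirect addressing; a negative index counts as `0`). -/
inductive Expr : Type
  | const (z : ℤ)
  | load (a : ℕ) (e : Expr)
  | add (e f : Expr)
  | sub (e f : Expr)
  | mul (e f : Expr)
  | div (e f : Expr)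

/-- The value of an expression; `div` is integer division, with quotient `0` for divisor `0`. -/
def Expr.eval (σ : Mem) : Expr → ℤ
  | .const z => z
  | .load a e => σ a (e.eval σ).toNat
  | .add e f => e.eval σ + f.eval σ
  | .sub e f => e.eval σ - f.eval σ
  | .mul e f => e.eval σ * f.eval σ
  | .div e f => e.eval σ / f.eval σ

/-- The logarithmic cost of evaluating an expression: each operation is charged the bit length
of its result, on top of the cost of computing its operands. -/
def Expr.cost (σ : Mem) : Expr → ℕ
  | .const z => bitSize z
  | .load a e => e.cost σ + bitSize ((Expr.load a e).eval σ)
  | .add e f => e.cost σ + f.cost σ + bitSize ((Expr.add e f).eval σ)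
  | .sub e f => e.cost σ + f.cost σ + bitSize ((Expr.sub e f).eval σ)
  | .mul e f => e.cost σ + f.cost σ + bitSize ((Expr.mul e f).eval σ)
  | .div e f => e.cost σ + f.cost σ + bitSize ((Expr.div e f).eval σ)

/-- Programs. `store a e f` writes the value of `f` into the cell of array `a` whose index is
the value of `e`; conditionals and loops test whether the value of an expression is positive. -/
inductive Program : Type
  | skip
  | store (a : ℕ) (e f : Expr)
  | seq (P Q : Program)
  | ite (e : Expr) (P Q : Program)
  | loop (e : Expr) (P : Program)

/-- `Exec P σ t τ`: started in memory `σ`, the program `P` halts in memory `τ`, at logarithmic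
cost `t`. -/
inductive Exec : Program → Mem → ℕ → Mem → Prop
  | skip (σ : Mem) : Exec .skip σ 1 σ
  | store (a : ℕ) (e f : Expr) (σ : Mem) :
      Exec (.store a e f) σ (1 + e.cost σ + f.cost σ) (σ.set a (e.eval σ).toNat (f.eval σ))
  | seq {P Q : Program} {σ τ ρ : Mem} {s t : ℕ} :
      Exec P σ s τ → Exec Q τ t ρ → Exec (.seq P Q) σ (s + t) ρ
  | ite_pos {e : Expr} {P Q : Program} {σ τ : Mem} {t : ℕ} :
      0 < e.eval σ → Exec P σ t τ → Exec (.ite e P Q) σ (1 + e.cost σ + t) τ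
  | ite_neg {e : Expr} {P Q : Program} {σ τ : Mem} {t : ℕ} :
      ¬ 0 < e.eval σ → Exec Q σ t τ → Exec (.ite e P Q) σ (1 + e.cost σ + t) τ
  | loop_done {e : Expr} {P : Program} {σ : Mem} :
      ¬ 0 < e.eval σ → Exec (.loop e P) σ (1 + e.cost σ) σ
  | loop_step {e : Expr} {P : Program} {σ τ ρ : Mem} {s t : ℕ} :
      0 < e.eval σ → Exec P σ s τ → Exec (.loop e P) τ t ρ →
      Exec (.loop e P) σ (1 + e.cost σ + s + t) ρ

/-- A list of integers laid out in an array: its length in cell `0`, its entries in the cells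
`1, 2, …`, and zeros afterwards. -/
def block (l : List ℤ) (k : ℕ) : ℤ := ((l.length : ℤ) :: l).getD k 0

/-- The initial memory: the input in array `0`, zeros everywhere else. -/
def initMem (l : List ℤ) : Mem := fun a k => if a = 0 then block l k else 0

/-- The memory holds the output `l` in array `1` (cells beyond the stated length are ignored). -/
def Mem.HasOutput (σ : Mem) (l : List ℤ) : Prop := ∀ k ≤ l.length, σ 1 k = block l k

/-- The size of an input: the total length of the binary notations of its entries. -/
def inputSize (l : List ℤ) : ℕ := (l.map bitSize).sum

/-- A search problem with instances `x : X`, written as `enc x`, and a relation saying which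
outputs are correct for `x`, is solvable in polynomial time: one program halts on every instance
with a correct output, at a logarithmic cost that is at most a fixed polynomial in the bit length
of the instance. -/
def SolvableInPolyTime {X : Type} (enc : X → List ℤ) (correct : X → List ℤ → Prop) : Prop :=
  ∃ (P : Program) (p : Polynomial ℕ), ∀ x : X, ∃ (t : ℕ) (τ : Mem) (l : List ℤ),
    Exec P (initMem (enc x)) t τ ∧ t ≤ p.eval (inputSize (enc x)) ∧
      τ.HasOutput l ∧ correct x l

end Machine

section Problem

/-- A house allocation instance with `n` agents, `m` houses and nonnegative utilities, which are
rational so that the instance can be the input of a machine. -/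
structure RatInstance (n m : ℕ) where
  utility : Fin n → Fin m → ℚ
  utility_nonneg : ∀ i h, 0 ≤ utility i h

/-- The instance as an input: `n`, `m`, and then the utilities agent by agent, each as its
numerator followed by its denominator. -/
def RatInstance.encode {n m : ℕ} (I : RatInstance n m) : List ℤ :=
  (n : ℤ) :: (m : ℤ) ::
    (List.finRange n).flatMap fun i => (List.finRange m).flatMap fun h =>
      [(I.utility i h).num, ((I.utility i h).den : ℤ)]

/-- The list `l` describes a minimum-subsidy envy-free outcome of the instance: for each agent in
turn, it gives the index of her house and her subsidy as a fraction `p i / q i` of integers with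
positive denominator. -/
def RatInstance.IsSolution {n m : ℕ} (I : RatInstance n m) (l : List ℤ) : Prop :=
  ∃ (o : Outcome n m) (p q : Fin n → ℤ),
    o.IsMinimumSubsidyEnvyFree (fun i h => (I.utility i h : ℝ)) ∧
    (∀ i, 0 < q i ∧ o.subsidy i = (p i : ℝ) / (q i : ℝ)) ∧
    l = (List.finRange n).flatMap fun i => [((o.house i : ℕ) : ℤ), p i, q i]

end Problem

end HouseAllocation

namespace HouseAllocation

/-! ### Bit lengths of integers -/

section BitLength

/-! In an outcome exactly `n` houses are used, and envy concerns only these. So fix a set `S` of `n`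
houses and attach the subsidies to the houses: an envy-free outcome on `S` is a bijection from
agents to `S` with prices `p ≥ 0` under which every agent gets a favourite house of `S`. The total
subsidy is the sum of `p` over `S`, whatever the bijection. Hence a perfect tight matching whose
prices are pointwise below those of every envy-free outcome on `S` is optimal for `S`
(`IsLowerSubsidy.sum_le`).

Such prices come from the Hungarian method. Starting from zero prices, the houses of `S` are added
one at a time as roots of a search. The search keeps a set `R` of reached houses and, for each `h ∈
R`, a tight matching `F h` that leaves `h` free instead of the root. The prices on `R` are raised by
the least amount that makes some unreached agent want a reached house. If that agent has a house, it
joins `R`; if not, the matching is augmented. The crucial point is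
`IsSearchState.isLowerSubsidy_raise`: a raise never overshoots an envy-free outcome, by a Hall-type
count against `F h`. Since `R` grows inside `S`, a search takes at most `n` steps.

As `m = n + c`, the sets `S` are obtained by deleting `c` houses with `c` nested loops, and the
cheapest outcome found is kept (`run_enumerate`). Utilities are first scaled by the product of all
denominators, so that prices are integers over one common denominator.

For the running time, every loop has `n` or `m` rounds, and every product has an input cell as
second factor. Each operation then adds only boundedly many multiples of the input bit length `B` to
the largest bit length. A program of weight `w` started with cells of at most `b` bits costs at most
`w * (b + w * B)`, and `w` is a polynomial in the number of rounds (`Code.reachesWithin_compile`).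
Its degree may depend on `c`, which is constant. -/

theorem bitSize_le_succ_iff {z : ℤ} {b : ℕ} : bitSize z ≤ b + 1 ↔ z.natAbs < 2 ^ b := by
  rw [bitSize, Nat.add_le_add_iff_right, Nat.size_le]

theorem one_le_bitSize (z : ℤ) : 1 ≤ bitSize z := Nat.le_add_left _ _

theorem bitSize_le_of_natAbs_le {y z : ℤ} (h : y.natAbs ≤ z.natAbs) : bitSize y ≤ bitSize z :=
  Nat.add_le_add_right (Nat.size_le_size h) 1

theorem bitSize_le_of_natAbs_add_le {x y z : ℤ} {b : ℕ} (h : z.natAbs ≤ x.natAbs + y.natAbs)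
    (hx : bitSize x ≤ b) (hy : bitSize y ≤ b) : bitSize z ≤ b + 1 := by
  obtain ⟨b, rfl⟩ := Nat.exists_eq_add_of_le' ((one_le_bitSize x).trans hx)
  rw [bitSize_le_succ_iff] at *
  rw [pow_succ]
  omega

theorem bitSize_add_le {x y : ℤ} {b : ℕ} (hx : bitSize x ≤ b) (hy : bitSize y ≤ b) :
    bitSize (x + y) ≤ b + 1 :=
  bitSize_le_of_natAbs_add_le (Int.natAbs_add_le x y) hx hy

theorem bitSize_sub_le {x y : ℤ} {b : ℕ} (hx : bitSize x ≤ b) (hy : bitSize y ≤ b) :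
    bitSize (x - y) ≤ b + 1 :=
  bitSize_le_of_natAbs_add_le (Int.natAbs_sub_le x y) hx hy

theorem bitSize_mul_le {x y : ℤ} {a b : ℕ} (hx : bitSize x ≤ a) (hy : bitSize y ≤ b) :
    bitSize (x * y) ≤ a + b := by
  obtain ⟨a, rfl⟩ := Nat.exists_eq_add_of_le' ((one_le_bitSize x).trans hx)
  obtain ⟨b, rfl⟩ := Nat.exists_eq_add_of_le' ((one_le_bitSize y).trans hy)
  refine (bitSize_le_succ_iff (b := a + b)).2 ?_ |>.trans (by omega)
  rw [bitSize_le_succ_iff] at *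
  rw [Int.natAbs_mul, pow_add]
  exact Nat.mul_lt_mul'' hx hy

theorem bitSize_ediv_le (x y : ℤ) : bitSize (x / y) ≤ bitSize x :=
  bitSize_le_of_natAbs_le (Int.natAbs_ediv_le_natAbs x y)

theorem bitSize_natCast_le (k : ℕ) : bitSize k ≤ k + 1 := by
  rw [bitSize_le_succ_iff, Int.natAbs_natCast]
  exact Nat.lt_two_pow_self

end BitLength

/-! ### Expressions whose values grow slowly -/

section TameExpressions

instance : Add Expr := ⟨Expr.add⟩
instance : Sub Expr := ⟨Expr.sub⟩
instance : Mul Expr := ⟨Expr.mul⟩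
instance : Div Expr := ⟨Expr.div⟩
instance (k : ℕ) : OfNat Expr k := ⟨Expr.const k⟩

/-- The content of cell `0` of an array that is used as a single variable. -/
def var (a : ℕ) : Expr := Expr.load a 0

variable (σ : Mem)

@[simp] theorem Expr.eval_add (e f : Expr) : (e + f).eval σ = e.eval σ + f.eval σ := rfl
@[simp] theorem Expr.eval_sub (e f : Expr) : (e - f).eval σ = e.eval σ - f.eval σ := rfl
@[simp] theorem Expr.eval_mul (e f : Expr) : (e * f).eval σ = e.eval σ * f.eval σ := rfl
@[simp] theorem Expr.eval_div (e f : Expr) : (e / f).eval σ = e.eval σ / f.eval σ := rfl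
@[simp] theorem Expr.eval_load (a : ℕ) (e : Expr) :
    (Expr.load a e).eval σ = σ a (e.eval σ).toNat := rfl
@[simp] theorem Expr.eval_zero : (0 : Expr).eval σ = 0 := rfl
@[simp] theorem Expr.eval_one : (1 : Expr).eval σ = 1 := rfl
@[simp] theorem Expr.eval_ofNat (k : ℕ) [k.AtLeastTwo] :
    (no_index (OfNat.ofNat k : Expr)).eval σ = OfNat.ofNat k := rfl
@[simp] theorem eval_var (a : ℕ) : (var a).eval σ = σ a 0 := rfl

/-- The expression reads a cell of the input array. -/
def Expr.isInput : Expr → Bool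
  | .load 0 _ => true
  | _ => false

/-- The only products in the expression have a cell of the input array as their second factor. -/
def Expr.isTame : Expr → Bool
  | .const _ => true
  | .load _ e => e.isTame
  | .add e f => e.isTame && f.isTame
  | .sub e f => e.isTame && f.isTame
  | .mul e f => e.isTame && f.isTame && f.isInput
  | .div e f => e.isTame && f.isTame

/-- A constant that governs the bit length of the value and the cost of a tame expression. -/
def Expr.weight : Expr → ℕ
  | .const z => bitSize z
  | .load _ e => e.weight + 1
  | .add e f => e.weight + f.weight + 1
  | .sub e f => e.weight + f.weight + 1
  | .mul e f => e.weight + f.weight + 1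
  | .div e f => e.weight + f.weight + 1

variable {σ}

/-- Bit lengths grow additively: a sum or difference adds one bit, a quotient is no longer than its
dividend, and a product adds at most `B` bits because its second factor is an input cell. A load is
bounded by `b` whatever its index is. -/
theorem Expr.bitSize_eval_le {b B : ℕ} (hb : ∀ a k, bitSize (σ a k) ≤ b)
    (hB : ∀ k, bitSize (σ 0 k) ≤ B) (e : Expr) (he : e.isTame) :
    bitSize (e.eval σ) ≤ b + e.weight * B := by
  have hB1 : 1 ≤ B := (one_le_bitSize _).trans (hB 0)
  induction e with
  | const z => exact (Nat.le_mul_of_pos_right _ hB1).trans (Nat.le_add_left _ _)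
  | load a e ih => exact (hb _ _).trans (Nat.le_add_right _ _)
  | add e f ihe ihf =>
    simp only [isTame, Bool.and_eq_true] at he
    refine (bitSize_add_le (b := b + (e.weight + f.weight) * B) ((ihe he.1).trans (by nlinarith))
      ((ihf he.2).trans (by nlinarith))).trans ?_
    simp only [weight]
    nlinarith
  | sub e f ihe ihf =>
    simp only [isTame, Bool.and_eq_true] at he
    refine (bitSize_sub_le (b := b + (e.weight + f.weight) * B) ((ihe he.1).trans (by nlinarith))
      ((ihf he.2).trans (by nlinarith))).trans ?_
    simp only [weight]
    nlinarith
  | mul e f ihe ihf =>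
    simp only [isTame, Bool.and_eq_true] at he
    have hf : bitSize (f.eval σ) ≤ B := by
      have := he.2
      unfold isInput at this
      split at this
      · exact hB _
      · simp at this
    refine (bitSize_mul_le (ihe he.1.1) hf).trans ?_
    simp only [weight]
    nlinarith
  | div e f ihe ihf =>
    simp only [isTame, Bool.and_eq_true] at he
    refine (bitSize_ediv_le _ _).trans ((ihe he.1).trans ?_)
    simp only [weight]
    nlinarith

theorem Expr.cost_le {b B : ℕ} (hb : ∀ a k, bitSize (σ a k) ≤ b)
    (hB : ∀ k, bitSize (σ 0 k) ≤ B) (e : Expr) (he : e.isTame) :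
    e.cost σ ≤ e.weight * (b + e.weight * B) := by
  have hB1 : 1 ≤ B := (one_le_bitSize _).trans (hB 0)
  -- The bound is superadditive in the weight, with room for the result of one more operation. Loads
  -- use it with a second operand of weight and cost `0`.
  have binary : ∀ {x y z w₁ w₂ : ℕ}, x ≤ w₁ * (b + w₁ * B) → y ≤ w₂ * (b + w₂ * B) →
      z ≤ b + (w₁ + w₂ + 1) * B → x + y + z ≤ (w₁ + w₂ + 1) * (b + (w₁ + w₂ + 1) * B) := by
    intro x y z w₁ w₂ hx hy hz
    have h₁ : w₁ * (b + w₁ * B) ≤ w₁ * (b + (w₁ + w₂ + 1) * B) := by gcongr; omega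
    have h₂ : w₂ * (b + w₂ * B) ≤ w₂ * (b + (w₁ + w₂ + 1) * B) := by gcongr; omega
    linarith
  have hbit := Expr.bitSize_eval_le hb hB e he
  induction e with
  | const z =>
    have h1 := one_le_bitSize z
    have : bitSize z * 1 ≤ bitSize z * (b + bitSize z * B) := by gcongr; nlinarith
    simpa [cost, weight] using this
  | load a e ih =>
    have := binary (ih he (Expr.bitSize_eval_le hb hB e he)) (y := 0) (w₂ := 0) (by simp) hbit
    simpa [cost, weight] using this
  | add e f ihe ihf =>
    simp only [isTame, Bool.and_eq_true] at he
    exact binary (ihe he.1 (Expr.bitSize_eval_le hb hB e he.1))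
      (ihf he.2 (Expr.bitSize_eval_le hb hB f he.2)) hbit
  | sub e f ihe ihf =>
    simp only [isTame, Bool.and_eq_true] at he
    exact binary (ihe he.1 (Expr.bitSize_eval_le hb hB e he.1))
      (ihf he.2 (Expr.bitSize_eval_le hb hB f he.2)) hbit
  | mul e f ihe ihf =>
    simp only [isTame, Bool.and_eq_true] at he
    exact binary (ihe he.1.1 (Expr.bitSize_eval_le hb hB e he.1.1))
      (ihf he.1.2 (Expr.bitSize_eval_le hb hB f he.1.2)) hbit
  | div e f ihe ihf =>
    simp only [isTame, Bool.and_eq_true] at he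
    exact binary (ihe he.1 (Expr.bitSize_eval_le hb hB e he.1))
      (ihf he.2 (Expr.bitSize_eval_le hb hB f he.2)) hbit

end TameExpressions

/-! ### Counting loops, their semantics and their cost -/

section LoopPrograms

@[simp] theorem Mem.set_same (σ : Mem) (a k : ℕ) (z : ℤ) (k' : ℕ) :
    σ.set a k z a k' = if k' = k then z else σ a k' := by
  simp [Mem.set]

@[simp] theorem Mem.set_of_ne (σ : Mem) {a a' : ℕ} (k : ℕ) (z : ℤ) (h : a' ≠ a) :
    σ.set a k z a' = σ a' := by
  funext k'
  simp [Mem.set, h]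

/-- Loop programs: the only loops are counting loops, `count v k P` runs `P` with variable `v`
going from `0` up to (but excluding) the value of cell `k` of the input array. -/
inductive Code : Type
  | skip
  | store (a : ℕ) (e f : Expr)
  | seq (P Q : Code)
  | ite (e : Expr) (P Q : Code)
  | count (v k : ℕ) (P : Code)

namespace Code

/-- Assignment to a single variable. -/
abbrev assign (a : ℕ) (f : Expr) : Code := store a 0 f

/-- Conditional without alternative. -/
abbrev cond (e : Expr) (P : Code) : Code := ite e P skip

/-- The body of the loop that implements `count v k P`. -/
def countBody (v : ℕ) (P : Program) : Program := P.seq (.store v 0 (var v + 1))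

/-- The loop that implements `count v k P`. -/
def countLoop (v k : ℕ) (P : Program) : Program :=
  .loop (Expr.load 0 (Expr.const k) - var v) (countBody v P)

/-- Translation into the language of the machine. -/
def compile : Code → Program
  | skip => .skip
  | store a e f => .store a e f
  | seq P Q => .seq P.compile Q.compile
  | ite e P Q => .ite e P.compile Q.compile
  | count v k P => .seq (.store v 0 0) (countLoop v k P.compile)

/-- The final memory. -/
def run : Code → Mem → Mem
  | skip, σ => σ
  | store a e f, σ => σ.set a (e.eval σ).toNat (f.eval σ)
  | seq P Q, σ => Q.run (P.run σ)
  | ite e P Q, σ => if 0 < e.eval σ then P.run σ else Q.run σ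
  | count v k P, σ =>
    Nat.rec (σ.set v 0 0) (fun i τ => (P.run τ).set v 0 ((i + 1 : ℕ) : ℤ)) (σ 0 k).toNat

/-- The arrays that occur as targets of assignments. -/
def writes : Code → List ℕ
  | skip => []
  | store a _ _ => [a]
  | seq P Q => P.writes ++ Q.writes
  | ite _ P Q => P.writes ++ Q.writes
  | count v _ P => v :: P.writes

/-- The program is made of tame expressions, does not write to the input array, does not write to
the counter of a running loop, and runs its loops up to one of the first two entries of the
input. -/
def isTame : Code → Bool
  | skip => true
  | store a e f => a != 0 && e.isTame && f.isTame
  | seq P Q => P.isTame && Q.isTame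
  | ite e P Q => e.isTame && P.isTame && Q.isTame
  | count v k P => v != 0 && (k == 1 || k == 2) && !P.writes.contains v && P.isTame

/-- The weight of a program, as a polynomial in a bound on the number of rounds of its loops. -/
noncomputable def weight : Code → Polynomial ℕ
  | skip => 1
  | store _ e f => ((e.weight + f.weight + 1 : ℕ) : Polynomial ℕ)
  | seq P Q => P.weight + Q.weight
  | ite e P Q => ((e.weight + 1 : ℕ) : Polynomial ℕ) + P.weight + Q.weight
  | count v k P => 3 + (Polynomial.X + 1) *
      (P.weight + (((Expr.load 0 (Expr.const k) - var v).weight +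
        (var v + 1).weight + 5 : ℕ) : Polynomial ℕ))

/-- The frame rule. It reduces most questions about unchanged memory to a decidable check on a list
of array numbers. -/
theorem run_of_notMem_writes {a : ℕ} (P : Code) (σ : Mem) (h : a ∉ P.writes) :
    P.run σ a = σ a := by
  induction P generalizing σ with
  | skip => rfl
  | store a' e f =>
    simp only [writes, List.mem_singleton] at h
    exact Mem.set_of_ne _ _ _ h
  | seq P Q ihP ihQ =>
    simp only [writes, List.mem_append, not_or] at h
    rw [run, ihQ _ h.2, ihP _ h.1]
  | ite e P Q ihP ihQ =>
    simp only [writes, List.mem_append, not_or] at h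
    rw [run]
    split
    · exact ihP _ h.1
    · exact ihQ _ h.2
  | count v k P ih =>
    simp only [writes, List.mem_cons, not_or] at h
    rw [run]
    induction (σ 0 k).toNat with
    | zero => exact Mem.set_of_ne _ _ _ h.1
    | succ i hi =>
      change ((P.run _).set v 0 _) a = _
      rw [Mem.set_of_ne _ _ _ h.1, ih _ h.2, hi]

theorem run_seq (P Q : Code) (σ : Mem) : (seq P Q).run σ = Q.run (P.run σ) := rfl

theorem run_ite_pos {e : Expr} {σ : Mem} (h : 0 < e.eval σ) (P Q : Code) :
    (ite e P Q).run σ = P.run σ := if_pos h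

theorem run_ite_neg {e : Expr} {σ : Mem} (h : ¬ 0 < e.eval σ) (P Q : Code) :
    (ite e P Q).run σ = Q.run σ := if_neg h

/-- The invariant rule for counting loops. Arrays that the loop does not write keep their
contents. -/
theorem count_induction {v k : ℕ} {P : Code} {σ : Mem} {N : ℕ} (hN : σ 0 k = N)
    (I : ℕ → Mem → Prop) (h₀ : I 0 (σ.set v 0 0))
    (hstep : ∀ i τ, i < N → τ v 0 = (i : ℤ) → (∀ a, a ∉ (count v k P).writes → τ a = σ a) → I i τ →
      I (i + 1) ((P.run τ).set v 0 ((i + 1 : ℕ) : ℤ))) :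
    I N ((count v k P).run σ) := by
  -- The invariant is carried together with the value of the counter and the frame condition, which
  -- is what allows `hstep` to assume both.
  have key : ∀ i, i ≤ N → ∀ τ : Mem,
      τ = Nat.rec (σ.set v 0 0) (fun i τ => (P.run τ).set v 0 ((i + 1 : ℕ) : ℤ)) i →
      I i τ ∧ τ v 0 = (i : ℤ) ∧ ∀ a, a ∉ (count v k P).writes → τ a = σ a := by
    intro i
    induction i with
    | zero =>
      rintro - τ rfl
      refine ⟨h₀, by simp, fun a ha => ?_⟩
      simp only [writes, List.mem_cons, not_or] at ha
      exact Mem.set_of_ne _ _ _ ha.1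
    | succ i ih =>
      rintro hi τ rfl
      obtain ⟨h₁, h₂, h₃⟩ := ih (by omega) _ rfl
      refine ⟨hstep i _ (by omega) h₂ h₃ h₁, by simp, fun a ha => ?_⟩
      have ha' := ha
      simp only [writes, List.mem_cons, not_or] at ha
      change ((P.run _).set v 0 _) a = _
      rw [Mem.set_of_ne _ _ _ ha.1, run_of_notMem_writes _ _ ha.2, h₃ a ha']
  have := (key N le_rfl _ rfl).1
  rw [run, hN]
  exact this

end Code

/-- From memory `σ`, with all cells of bit length at most `b`, the program reaches `τ` at a cost,
and with cells of a bit length, governed by the weight `w`; here `B` bounds the bit lengths of the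
input. -/
def ReachesWithin (w b B : ℕ) (P : Program) (σ τ : Mem) : Prop :=
  ∃ t, Exec P σ t τ ∧ t ≤ w * (b + w * B) ∧ ∀ a k, bitSize (τ a k) ≤ b + w * B

/-- Why costs have the form `w * (b + w * B)`: the form is closed under sequencing, when the second
program starts with the bit bound `b + w₁ * B` left behind by the first. -/
theorem weight_sum_le {w₁ w₂ b B : ℕ} :
    w₁ * (b + w₁ * B) + w₂ * (b + w₁ * B + w₂ * B) ≤ (w₁ + w₂) * (b + (w₁ + w₂) * B) := by
  have h₁ : w₁ * (b + w₁ * B) ≤ w₁ * (b + (w₁ + w₂) * B) := by gcongr; omega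
  linarith

namespace ReachesWithin

variable {b B w w₁ w₂ : ℕ} {P Q : Program} {σ τ ρ : Mem} {e f : Expr}

theorem mono {w' : ℕ} (h : ReachesWithin w b B P σ τ) (hw : w ≤ w') :
    ReachesWithin w' b B P σ τ := by
  obtain ⟨t, h₁, h₂, h₃⟩ := h
  exact ⟨t, h₁, h₂.trans (by gcongr), fun a k => (h₃ a k).trans (by gcongr)⟩

theorem seq (h₁ : ReachesWithin w₁ b B P σ τ) (h₂ : ReachesWithin w₂ (b + w₁ * B) B Q τ ρ) :
    ReachesWithin (w₁ + w₂) b B (P.seq Q) σ ρ := by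
  obtain ⟨s, hs, hs', -⟩ := h₁
  obtain ⟨t, ht, ht', hρ⟩ := h₂
  exact ⟨s + t, .seq hs ht, (Nat.add_le_add hs' ht').trans weight_sum_le,
    fun a k => (hρ a k).trans (by linarith)⟩

theorem skip (hb : ∀ a k, bitSize (σ a k) ≤ b) (hB : ∀ k, bitSize (σ 0 k) ≤ B) :
    ReachesWithin 1 b B .skip σ σ := by
  have := one_le_bitSize _ |>.trans (hB 0)
  exact ⟨1, .skip σ, by omega, fun a k => (hb a k).trans (by omega)⟩

theorem store (hb : ∀ a k, bitSize (σ a k) ≤ b) (hB : ∀ k, bitSize (σ 0 k) ≤ B) (a : ℕ)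
    (he : e.isTame) (hf : f.isTame) :
    ReachesWithin (e.weight + f.weight + 1) b B (.store a e f) σ
      (σ.set a (e.eval σ).toNat (f.eval σ)) := by
  have hB1 := one_le_bitSize _ |>.trans (hB 0)
  refine ⟨_, .store a e f σ, ?_, fun a' k' => ?_⟩
  · have h₁ := e.cost_le hb hB he
    have h₂ := f.cost_le hb hB hf
    have h₃ : e.weight * (b + e.weight * B) ≤
        e.weight * (b + (e.weight + f.weight + 1) * B) := by gcongr; omega
    have h₄ : f.weight * (b + f.weight * B) ≤
        f.weight * (b + (e.weight + f.weight + 1) * B) := by gcongr; omega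
    have h₅ : 1 ≤ (b + (e.weight + f.weight + 1) * B) := by nlinarith
    linarith
  · have h₁ := f.bitSize_eval_le hb hB hf
    have h₂ : f.weight * B ≤ (e.weight + f.weight + 1) * B := by gcongr; omega
    have h₃ := hb a' k'
    unfold Mem.set
    split <;> omega

theorem test (hb : ∀ a k, bitSize (σ a k) ≤ b) (hB : ∀ k, bitSize (σ 0 k) ≤ B) (he : e.isTame) :
    1 + e.cost σ ≤ (e.weight + 1) * (b + (e.weight + 1) * B) := by
  have hB1 := one_le_bitSize _ |>.trans (hB 0)
  have h₁ := e.cost_le hb hB he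
  have h₃ : e.weight * (b + e.weight * B) ≤ e.weight * (b + (e.weight + 1) * B) := by
    gcongr; omega
  have h₅ : 1 ≤ (b + (e.weight + 1) * B) := by nlinarith
  linarith

theorem ite_pos (hb : ∀ a k, bitSize (σ a k) ≤ b) (hB : ∀ k, bitSize (σ 0 k) ≤ B)
    (he : e.isTame) (h : 0 < e.eval σ)
    (hP : ReachesWithin w (b + (e.weight + 1) * B) B P σ τ) :
    ReachesWithin (e.weight + 1 + w) b B (.ite e P Q) σ τ := by
  obtain ⟨t, h₁, h₂, h₃⟩ := hP
  exact ⟨_, .ite_pos h h₁, (Nat.add_le_add (test hb hB he) h₂).trans weight_sum_le,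
    fun a k => (h₃ a k).trans (by linarith)⟩

theorem ite_neg (hb : ∀ a k, bitSize (σ a k) ≤ b) (hB : ∀ k, bitSize (σ 0 k) ≤ B)
    (he : e.isTame) (h : ¬ 0 < e.eval σ)
    (hQ : ReachesWithin w (b + (e.weight + 1) * B) B Q σ τ) :
    ReachesWithin (e.weight + 1 + w) b B (.ite e P Q) σ τ := by
  obtain ⟨t, h₁, h₂, h₃⟩ := hQ
  exact ⟨_, .ite_neg h h₁, (Nat.add_le_add (test hb hB he) h₂).trans weight_sum_le,
    fun a k => (h₃ a k).trans (by linarith)⟩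

theorem loop_done (hb : ∀ a k, bitSize (σ a k) ≤ b) (hB : ∀ k, bitSize (σ 0 k) ≤ B)
    (he : e.isTame) (h : ¬ 0 < e.eval σ) :
    ReachesWithin (e.weight + 1) b B (.loop e P) σ σ :=
  ⟨_, .loop_done h, test hb hB he, fun a k => (hb a k).trans (Nat.le_add_right _ _)⟩

theorem loop_step (hb : ∀ a k, bitSize (σ a k) ≤ b) (hB : ∀ k, bitSize (σ 0 k) ≤ B)
    (he : e.isTame) (h : 0 < e.eval σ)
    (h₁ : ReachesWithin w₁ (b + (e.weight + 1) * B) B P σ τ)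
    (h₂ : ReachesWithin w₂ (b + (e.weight + 1 + w₁) * B) B (.loop e P) τ ρ) :
    ReachesWithin (e.weight + 1 + w₁ + w₂) b B (.loop e P) σ ρ := by
  obtain ⟨s, hs, hs', -⟩ := h₁
  obtain ⟨t, ht, ht', hρ⟩ := h₂
  refine ⟨_, .loop_step h hs ht, ?_, fun a k => (hρ a k).trans (by linarith)⟩
  exact (Nat.add_le_add ((Nat.add_le_add (test hb hB he) hs').trans weight_sum_le) ht').trans
    weight_sum_le

theorem bits_mono {b' : ℕ} (hb : ∀ a k, bitSize (σ a k) ≤ b) (h : b ≤ b') (a k : ℕ) :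
    bitSize (σ a k) ≤ b' := (hb a k).trans h

end ReachesWithin

namespace Code

theorem zero_notMem_writes (P : Code) (hP : P.isTame) : 0 ∉ P.writes := by
  induction P with
  | skip => simp [writes]
  | store a e f =>
    simp only [isTame, Bool.and_eq_true, bne_iff_ne] at hP
    simpa [writes] using hP.1.1.symm
  | seq P Q ihP ihQ =>
    simp only [isTame, Bool.and_eq_true] at hP
    simp [writes, ihP hP.1, ihQ hP.2]
  | ite e P Q ihP ihQ =>
    simp only [isTame, Bool.and_eq_true] at hP
    simp [writes, ihP hP.1.2, ihQ hP.2]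
  | count v k P ih =>
    simp only [isTame, Bool.and_eq_true, bne_iff_ne] at hP
    simp [writes, ih hP.2, hP.1.1.1.symm]

/-- Weights add along the execution. A tame program never writes the input array, so `B` and the
loop bounds stay the same throughout, and a loop multiplies the weight of its body by at most `M +
1`. -/
theorem reachesWithin_compile {M B : ℕ} (P : Code) (hP : P.isTame) {σ : Mem} {b : ℕ}
    (hb : ∀ a k, bitSize (σ a k) ≤ b) (hB : ∀ k, bitSize (σ 0 k) ≤ B)
    (hM₁ : (σ 0 1).toNat ≤ M) (hM₂ : (σ 0 2).toNat ≤ M) :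
    ReachesWithin (P.weight.eval M) b B P.compile σ (P.run σ) := by
  induction P generalizing σ b with
  | skip => simpa [weight, run, compile] using ReachesWithin.skip hb hB
  | store a e f =>
    simp only [isTame, Bool.and_eq_true] at hP
    rw [weight, Polynomial.eval_natCast, Nat.cast_id]
    exact ReachesWithin.store hb hB a hP.1.2 hP.2
  | seq P Q ihP ihQ =>
    simp only [isTame, Bool.and_eq_true] at hP
    have h₁ := ihP hP.1 hb hB hM₁ hM₂
    have h0 := run_of_notMem_writes P σ (zero_notMem_writes P hP.1)
    rw [weight, Polynomial.eval_add]
    refine h₁.seq (ihQ hP.2 ?_ ?_ ?_ ?_)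
    · obtain ⟨-, -, -, h⟩ := h₁
      exact h
    all_goals rwa [h0]
  | ite e P Q ihP ihQ =>
    simp only [isTame, Bool.and_eq_true] at hP
    rw [weight, Polynomial.eval_add, Polynomial.eval_add, Polynomial.eval_natCast, Nat.cast_id,
      run]
    split
    · next h =>
      refine (ReachesWithin.ite_pos hb hB hP.1.1 h (ihP hP.1.2 ?_ hB hM₁ hM₂)).mono (by omega)
      exact ReachesWithin.bits_mono hb (Nat.le_add_right _ _)
    · next h =>
      refine (ReachesWithin.ite_neg hb hB hP.1.1 h (ihQ hP.2 ?_ hB hM₁ hM₂)).mono (by omega)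
      exact ReachesWithin.bits_mono hb (Nat.le_add_right _ _)
  | count v k P ih =>
    have hzero := zero_notMem_writes _ hP
    simp only [writes, List.mem_cons, not_or] at hzero
    simp only [isTame, Bool.and_eq_true, bne_iff_ne, Bool.or_eq_true, beq_iff_eq,
      Bool.not_eq_true', List.contains_eq_mem, decide_eq_false_iff_not] at hP
    obtain ⟨⟨⟨hv0, hk⟩, hvP⟩, hP⟩ := hP
    set N := (σ 0 k).toNat with hN
    have hNM : N ≤ M := by rcases hk with rfl | rfl <;> assumption
    set S : ℕ → Mem := fun i =>
      Nat.rec (σ.set v 0 0) (fun i τ => (P.run τ).set v 0 ((i + 1 : ℕ) : ℤ)) i with hS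
    have hS0 : ∀ i, S i 0 = σ 0 := by
      intro i
      induction i with
      | zero => exact Mem.set_of_ne _ _ _ hzero.1
      | succ i hi =>
        change ((P.run (S i)).set v 0 _) 0 = _
        rw [Mem.set_of_ne _ _ _ hzero.1, run_of_notMem_writes _ _ hzero.2, hi]
    have hSv : ∀ i, S i v 0 = i := by
      intro i
      cases i with
      | zero => simp [hS]
      | succ i => simp [hS]
    set q := P.weight.eval M + ((Expr.load 0 (Expr.const k) - var v).weight +
      (var v + 1).weight + 5) with hq
    have htame : (Expr.load 0 (Expr.const k) - var v).isTame = true := rfl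
    -- Induction on the number `j` of remaining rounds, from the memory `S i` after `i` rounds. The
    -- factor `j + 1` includes the final, failing test.
    have loop : ∀ j i b, i + j = N → (∀ a k, bitSize (S i a k) ≤ b) →
        ReachesWithin ((j + 1) * q) b B (countLoop v k P.compile) (S i) (S N) := by
      intro j
      induction j with
      | zero =>
        intro i b hij hb
        obtain rfl : i = N := by omega
        refine (ReachesWithin.loop_done hb (by rwa [hS0]) htame ?_).mono (by omega)
        have hk' : ((Expr.const (k : ℤ)).eval (S N)).toNat = k := Int.toNat_natCast k
        simp only [Expr.eval_sub, Expr.eval_load, eval_var, hS0, hSv, hk']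
        omega
      | succ j ihj =>
        intro i b hij hb
        have h₁ := ih hP (σ := S i)
          (b := b + ((Expr.load 0 (Expr.const k) - var v).weight + 1) * B)
          (ReachesWithin.bits_mono hb (Nat.le_add_right _ _)) (by rwa [hS0]) (by rwa [hS0])
          (by rwa [hS0])
        have h₂ : ReachesWithin _ _ B _ (P.run (S i)) _ :=
          ReachesWithin.store (e := 0) (f := var v + 1) h₁.choose_spec.2.2
            (by rwa [run_of_notMem_writes _ _ hzero.2, hS0]) v rfl rfl
        -- The machine increments the counter, whereas `run` sets it to `i + 1`. They agree because
        -- the body does not write `v`.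
        have heq : (P.run (S i)).set v ((0 : Expr).eval (P.run (S i))).toNat
            ((var v + 1).eval (P.run (S i))) = S (i + 1) := by
          have : (P.run (S i)) v 0 = i := by rw [run_of_notMem_writes _ _ hvP, hSv]
          have h' : S (i + 1) = (P.run (S i)).set v 0 ((i + 1 : ℕ) : ℤ) := rfl
          simp [this, h']
        rw [heq] at h₂
        have h₃ := (h₁.seq h₂)
        have h₄ := ihj (i + 1) _ (by omega) (ReachesWithin.bits_mono h₃.choose_spec.2.2
          (b' := b + ((Expr.load 0 (Expr.const k) - var v).weight + 1 +
            (Polynomial.eval M P.weight +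
              ((0 : Expr).weight + (var v + 1).weight + 1))) * B) (by linarith))
        refine (ReachesWithin.loop_step hb (by rwa [hS0]) htame ?_ h₃ h₄).mono ?_
        · have hk' : ((Expr.const (k : ℤ)).eval (S i)).toNat = k := Int.toNat_natCast k
          simp only [Expr.eval_sub, Expr.eval_load, eval_var, hS0, hSv, hk']
          omega
        · have : (0 : Expr).weight = 1 := rfl
          rw [this, add_mul (j + 1) 1 q, one_mul]
          omega
    have h₀ := ReachesWithin.store (e := 0) (f := 0) hb hB v rfl rfl
    have := h₀.seq (loop N 0 _ (by omega) h₀.choose_spec.2.2)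
    refine this.mono ?_
    have hw : (0 : Expr).weight = 1 := rfl
    simp only [weight, Polynomial.eval_add, Polynomial.eval_mul, Polynomial.eval_natCast,
      Polynomial.eval_X, Polynomial.eval_one, Polynomial.eval_ofNat, Nat.cast_id, hw]
    -- The summand `3` pays for resetting the counter.
    refine Nat.add_le_add le_rfl (Nat.mul_le_mul (by omega) (by omega))

end Code

end LoopPrograms

/-! ### The Hungarian method for a fixed set of `n` houses -/

section HungarianMethod

/-- All agents are assigned distinct houses of `S`, and the subsidies `p` of the houses make the
assignment envy-free. Houses are positive numbers and agents are the numbers below `n`. -/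
structure IsSupported (n : ℕ) (u : ℕ → ℕ → ℤ) (S : Finset ℕ) (a : ℕ → ℕ) (p : ℕ → ℝ) : Prop where
  mem : ∀ i < n, a i ∈ S
  inj : ∀ i < n, ∀ j < n, a i = a j → i = j
  nonneg : ∀ h ∈ S, 0 ≤ p h
  envy_free : ∀ i < n, ∀ h ∈ S, (u i h : ℝ) + p h ≤ u i (a i) + p (a i)

/-- No house subsidy exceeds the one in any envy-free outcome on `S`. -/
structure IsLowerSubsidy (n : ℕ) (u : ℕ → ℕ → ℤ) (S : Finset ℕ) (p : ℕ → ℤ) : Prop where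
  nonneg : ∀ h ∈ S, 0 ≤ p h
  le : ∀ a p', IsSupported n u S a p' → ∀ h ∈ S, (p h : ℝ) ≤ p' h

/-- An assignment of some agents to the houses in `M` under which each assigned agent gets a
favourite house among those of `S`; the value `0` marks an agent without a house. -/
structure IsTightMatching (n : ℕ) (u : ℕ → ℕ → ℤ) (S M : Finset ℕ) (p : ℕ → ℤ) (f : ℕ → ℕ) :
    Prop where
  mem : ∀ i < n, f i ≠ 0 → f i ∈ M
  inj : ∀ i < n, ∀ j < n, f i ≠ 0 → f i = f j → i = j
  surj : ∀ h ∈ M, ∃ i < n, f i = h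
  tight : ∀ i < n, f i ≠ 0 → ∀ h ∈ S, u i h + p h ≤ u i (f i) + p (f i)

/-- The state of a search for an augmenting path that starts from the free house `r`: the houses
in `R` have been reached, and `F h` is the matching in which house `h` is free instead of `r`. -/
structure IsSearchState (n : ℕ) (u : ℕ → ℕ → ℤ) (S M : Finset ℕ) (r : ℕ) (p : ℕ → ℤ)
    (f : ℕ → ℕ) (R : Finset ℕ) (F : ℕ → ℕ → ℕ) : Prop where
  lower : IsLowerSubsidy n u S p
  base : IsTightMatching n u S M p f
  root_mem : r ∈ R
  subset : R ⊆ insert r M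
  matching : ∀ h ∈ R, IsTightMatching n u S ((insert r M).erase h) p (F h)
  outside : ∀ h ∈ R, ∀ i < n, f i ∉ R → F h i = f i
  inside : ∀ h ∈ R, ∀ i < n, f i ∈ R → F h i ∈ R ∧ F h i ≠ h

/-- Raise the subsidies of the houses in `R`. -/
def raise (p : ℕ → ℤ) (R : Finset ℕ) (δ : ℤ) (h : ℕ) : ℤ := if h ∈ R then p h + δ else p h

/-- The agent `i₀` can be added to the search by way of house `h₀` if the subsidies of the reached
houses are raised by `δ`, which is the least amount for which there is such an agent. -/
structure IsSelected (n : ℕ) (u : ℕ → ℕ → ℤ) (S : Finset ℕ) (p : ℕ → ℤ) (f : ℕ → ℕ)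
    (R : Finset ℕ) (δ : ℤ) (i₀ h₀ : ℕ) : Prop where
  lt : i₀ < n
  agent_notMem : f i₀ ∉ R
  house_mem : h₀ ∈ R
  favourite : ∀ h ∈ S, u i₀ h + p h ≤ u i₀ h₀ + p h₀ + δ
  slack : ∀ i < n, f i ∉ R → ∀ h ∈ R, ∃ h' ∈ S, u i h + p h + δ ≤ u i h' + p h'

variable {n : ℕ} {u : ℕ → ℕ → ℤ} {S M R : Finset ℕ} {p : ℕ → ℤ} {f : ℕ → ℕ} {r i₀ h₀ : ℕ} {δ : ℤ}
  {F : ℕ → ℕ → ℕ}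

theorem IsTightMatching.exists_eq_zero (hf : IsTightMatching n u S M p f) (hM : M.card < n) :
    ∃ i < n, f i = 0 := by
  by_contra! h
  have := Finset.card_le_card_of_injOn f (s := Finset.range n) (t := M)
    (fun i hi => by
      have hi := Finset.mem_range.1 hi
      exact hf.mem i hi (h i hi))
    (fun i hi j hj hij => by
      have hi := Finset.mem_range.1 hi
      exact hf.inj i hi j (Finset.mem_range.1 hj) (h i hi) hij)
  rw [Finset.card_range] at this
  omega

/-- If some agent had no house, the remaining `n - 1` agents would have to cover all of `M`. -/
theorem IsTightMatching.ne_zero (hf : IsTightMatching n u S M p f) (hM : n ≤ M.card)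
    (h0 : 0 ∉ M) : ∀ i < n, f i ≠ 0 := by
  have hsub : M ⊆ (Finset.range n).image f := fun h hh => by
    obtain ⟨i, hi, rfl⟩ := hf.surj h hh
    exact Finset.mem_image_of_mem _ (Finset.mem_range.2 hi)
  intro i hi hfi
  have hsub' : M ⊆ ((Finset.range n).erase i).image f := fun h hh => by
    obtain ⟨j, hj, rfl⟩ := hf.surj h hh
    refine Finset.mem_image_of_mem _ (Finset.mem_erase.2 ⟨?_, Finset.mem_range.2 hj⟩)
    rintro rfl
    exact h0 (hfi ▸ hh)
  have h₁ := (Finset.card_le_card hsub').trans Finset.card_image_le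
  rw [Finset.card_erase_of_mem (Finset.mem_range.2 hi), Finset.card_range] at h₁
  exact absurd (hM.trans h₁) (by omega)

theorem image_eq_of_card {a : ℕ → ℕ} (hS : S.card = n) (hmem : ∀ i < n, a i ∈ S)
    (hinj : ∀ i < n, ∀ j < n, a i = a j → i = j) : (Finset.range n).image a = S := by
  apply Finset.eq_of_subset_of_card_le
  · intro x hx
    obtain ⟨i, hi, rfl⟩ := Finset.mem_image.1 hx
    exact hmem i (Finset.mem_range.1 hi)
  · rw [Finset.card_image_of_injOn, Finset.card_range, hS]
    exact fun i hi j hj => hinj i (by simpa using hi) j (by simpa using hj)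

theorem sum_comp_eq_sum {α : Type*} [AddCommMonoid α] {a : ℕ → ℕ} (hS : S.card = n)
    (hmem : ∀ i < n, a i ∈ S) (hinj : ∀ i < n, ∀ j < n, a i = a j → i = j) (g : ℕ → α) :
    ∑ i ∈ Finset.range n, g (a i) = ∑ h ∈ S, g h := by
  rw [← image_eq_of_card hS hmem hinj, Finset.sum_image fun i hi j hj =>
    hinj i (by simpa using hi) j (by simpa using hj)]

/-- Optimality for `S`: both assignments use up `S`, so both totals are sums over `S` and the
pointwise bound on prices can be summed. -/
theorem IsLowerSubsidy.sum_le (hp : IsLowerSubsidy n u S p) (hf : IsTightMatching n u S S p f)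
    (h0 : 0 ∉ S) (hS : S.card = n) {a : ℕ → ℕ} {p' : ℕ → ℝ} (ha : IsSupported n u S a p') :
    ((∑ i ∈ Finset.range n, p (f i) : ℤ) : ℝ) ≤ ∑ i ∈ Finset.range n, p' (a i) := by
  have hne := hf.ne_zero hS.ge h0
  rw [sum_comp_eq_sum hS (fun i hi => hf.mem i hi (hne i hi))
    (fun i hi j hj => hf.inj i hi j hj (hne i hi)), sum_comp_eq_sum hS ha.mem ha.inj]
  push_cast
  exact Finset.sum_le_sum fun h hh => hp.le a p' ha h hh

theorem isTightMatching_empty : IsTightMatching n u S ∅ p fun _ => 0 :=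
  ⟨fun _ _ h => absurd rfl h, fun _ _ _ _ h => absurd rfl h, by simp,
    fun _ _ h => absurd rfl h⟩

theorem isLowerSubsidy_of_eq_zero (hp : ∀ h ∈ S, p h = 0) : IsLowerSubsidy n u S p :=
  ⟨fun h hh => (hp h hh).ge, fun _ _ h' h hh => by simpa [hp h hh] using h'.nonneg h hh⟩

/-- The initial state of the search. -/
theorem IsTightMatching.isSearchState (hp : IsLowerSubsidy n u S p)
    (hf : IsTightMatching n u S M p f) (h0 : 0 ∉ S) (hr : r ∈ S) (hrM : r ∉ M) :
    IsSearchState n u S M r p f {r} fun _ => f where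
  lower := hp
  base := hf
  root_mem := Finset.mem_singleton_self r
  subset := by simp
  matching := by
    intro h hh
    rw [Finset.mem_singleton] at hh
    rwa [hh, Finset.erase_insert hrM]
  outside _ _ _ _ _ := rfl
  inside h _ i hi hfi := by
    rw [Finset.mem_singleton] at hfi
    have := hf.mem i hi (by rintro h; exact h0 (h ▸ hfi ▸ hr))
    exact absurd (hfi ▸ this) hrM

namespace IsSearchState

theorem reached_subset (hs : IsSearchState n u S M r p f R F) (hM : M ⊆ S) (hr : r ∈ S) :
    R ⊆ S :=
  hs.subset.trans (Finset.insert_subset hr hM)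

theorem delta_nonneg (hsel : IsSelected n u S p f R δ i₀ h₀) (hRS : R ⊆ S) : 0 ≤ δ := by
  have := hsel.favourite h₀ (hRS hsel.house_mem)
  omega

/-- Raising the subsidies of reached houses keeps a favourite house a favourite. -/
theorem tight_raise (hsel : IsSelected n u S p f R δ i₀ h₀) (hRS : R ⊆ S) {i g : ℕ} (hi : i < n)
    (hg : g ∈ R ∨ f i ∉ R) (htight : ∀ h ∈ S, u i h + p h ≤ u i g + p g) :
    ∀ h ∈ S, u i h + raise p R δ h ≤ u i g + raise p R δ g := by
  intro h hh
  have hδ := delta_nonneg hsel hRS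
  have h₁ := htight h hh
  unfold raise
  by_cases hgR : g ∈ R
  · rw [if_pos hgR]
    split <;> omega
  · rw [if_neg hgR]
    split
    · next hhR =>
      -- Here `g` is not raised, so the agent is unreached. By minimality of `δ`, a raised house is
      -- still no better for it than some `h'` was before, hence no better than `g`.
      obtain ⟨h', hh', hle⟩ := hsel.slack i hi (hg.resolve_left hgR) h hhR
      have := htight h' hh'
      omega
    · exact h₁

/-- Raised houses are controlled by `slack` for `i₀` itself, followed by `favourite`; the other
houses by `favourite` alone. -/
theorem favourite_raise (hsel : IsSelected n u S p f R δ i₀ h₀) :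
    ∀ h ∈ S, u i₀ h + raise p R δ h ≤ u i₀ h₀ + raise p R δ h₀ := by
  intro h hh
  unfold raise
  rw [if_pos hsel.house_mem]
  split
  · next hhR =>
    obtain ⟨h', hh', hle⟩ := hsel.slack i₀ hsel.lt hsel.agent_notMem h hhR
    have := hsel.favourite h' hh'
    omega
  · have := hsel.favourite h hh
    omega

/-- If the raised subsidies exceeded those of an envy-free outcome at `h`, then with
`X` the set of all such reached houses, the agents that this outcome assigns to `X` would
fit into `X \ {h}` under the matching `F h`. -/
theorem isLowerSubsidy_raise (hs : IsSearchState n u S M r p f R F)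
    (hsel : IsSelected n u S p f R δ i₀ h₀) (h0 : 0 ∉ S) (hRS : R ⊆ S) (hS : S.card = n) :
    IsLowerSubsidy n u S (raise p R δ) := by
  classical
  have hδ := delta_nonneg hsel hRS
  refine ⟨fun h hh => ?_, fun a p' ha h hh => ?_⟩
  · have := hs.lower.nonneg h hh
    unfold raise
    split <;> omega
  have hle := hs.lower.le a p' ha
  unfold raise
  split
  swap
  · exact hle h hh
  next hhR =>
  by_contra! hlt
  set X := R.filter fun x => p' x < ((p x + δ : ℤ) : ℝ) with hX
  set Y := (Finset.range n).filter fun i => a i ∈ X with hY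
  have himage := image_eq_of_card hS ha.mem ha.inj
  have hXY : X.card ≤ Y.card := by
    have : X ⊆ Y.image a := by
      intro x hx
      have hxS : x ∈ S := hRS (Finset.mem_filter.1 hx).1
      rw [← himage] at hxS
      obtain ⟨i, hi, rfl⟩ := Finset.mem_image.1 hxS
      exact Finset.mem_image_of_mem _ (Finset.mem_filter.2 ⟨hi, hx⟩)
    exact (Finset.card_le_card this).trans Finset.card_image_le
  -- An unreached agent has some `h'` worth at least `δ` more at prices `p` than `a i`. Since `p ≤
  -- p'` and it does not envy `h'`, the price `p' (a i)` is at least `p (a i) + δ`, so `a i ∉ X`.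
  have hYreached : ∀ i ∈ Y, f i ∈ R := by
    intro i hi
    obtain ⟨hi, hiX⟩ := Finset.mem_filter.1 hi
    have hi := Finset.mem_range.1 hi
    obtain ⟨hiR, hiX⟩ := Finset.mem_filter.1 hiX
    by_contra hfi
    obtain ⟨h', hh', hslack⟩ := hsel.slack i hi hfi _ hiR
    have h₁ := ha.envy_free i hi h' hh'
    have h₂ := hle h' hh'
    have h₃ : (u i (a i) : ℝ) + p (a i) + δ ≤ u i h' + p h' := by exact_mod_cast hslack
    push_cast at hiX
    linarith
  -- At prices `p` the agent likes `F h i` at least as much as `a i`, and at prices `p'` at most as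
  -- much. So if `p'` falls short of `p + δ` at `a i`, it does so at `F h i` as well.
  have hmaps : ∀ i ∈ Y, F h i ∈ X.erase h := by
    intro i hiY
    obtain ⟨hi, hiX⟩ := Finset.mem_filter.1 hiY
    have hi := Finset.mem_range.1 hi
    obtain ⟨hiR, hiX⟩ := Finset.mem_filter.1 hiX
    obtain ⟨hFR, hFh⟩ := hs.inside h hhR i hi (hYreached i hiY)
    refine Finset.mem_erase.2 ⟨hFh, Finset.mem_filter.2 ⟨hFR, ?_⟩⟩
    have hF0 : F h i ≠ 0 := fun h' => h0 (h' ▸ hRS hFR)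
    have h₁ := ha.envy_free i hi _ (hRS hFR)
    have h₂ := (hs.matching h hhR).tight i hi hF0 _ (hRS hiR)
    have h₃ : (u i (a i) : ℝ) + p (a i) ≤ u i (F h i) + p (F h i) := by exact_mod_cast h₂
    push_cast at hiX ⊢
    linarith
  have hcard := Finset.card_le_card_of_injOn (F h) hmaps (by
    intro i hi j hj hij
    have hiX := hRS (Finset.mem_filter.1 (Finset.mem_of_mem_erase (hmaps i hi))).1
    exact (hs.matching h hhR).inj i (Finset.mem_range.1 (Finset.mem_filter.1 hi).1) j
      (Finset.mem_range.1 (Finset.mem_filter.1 hj).1) (fun h' => h0 (h' ▸ hiX)) hij)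
  have hhX : h ∈ X := Finset.mem_filter.2 ⟨hhR, hlt⟩
  rw [Finset.card_erase_of_mem hhX] at hcard
  have := Finset.card_pos.2 ⟨h, hhX⟩
  omega

theorem isTightMatching_raise (hsel : IsSelected n u S p f R δ i₀ h₀) (hRS : R ⊆ S)
    {M' : Finset ℕ} {g : ℕ → ℕ} (hg : IsTightMatching n u S M' p g)
    (hreach : ∀ i < n, g i ∈ R ∨ f i ∉ R) :
    IsTightMatching n u S M' (raise p R δ) g where
  mem := hg.mem
  inj := hg.inj
  surj := hg.surj
  tight i hi hgi := tight_raise hsel hRS hi (hreach i hi) (hg.tight i hi hgi)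

theorem matching_raise (hs : IsSearchState n u S M r p f R F)
    (hsel : IsSelected n u S p f R δ i₀ h₀) (hRS : R ⊆ S) {h : ℕ} (hh : h ∈ R) :
    IsTightMatching n u S ((insert r M).erase h) (raise p R δ) (F h) := by
  refine isTightMatching_raise hsel hRS (hs.matching h hh) fun i hi => ?_
  by_cases hfi : f i ∈ R
  · exact Or.inl (hs.inside h hh i hi hfi).1
  · exact Or.inr hfi

/-- Moving the selected agent to the house by which it was reached. -/
theorem isTightMatching_update (hs : IsSearchState n u S M r p f R F)
    (hsel : IsSelected n u S p f R δ i₀ h₀) (h0 : 0 ∉ S) (hRS : R ⊆ S) :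
    IsTightMatching n u S ((insert r M).erase (f i₀)) (raise p R δ)
      (Function.update (F h₀) i₀ h₀) := by
  have hF := hs.matching_raise hsel hRS hsel.house_mem
  -- The selected agent is unreached, so `F h₀` still gives it `f i₀`; moving it to the free house
  -- `h₀` makes `f i₀` the new hole.
  have hFi : F h₀ i₀ = f i₀ := hs.outside _ hsel.house_mem _ hsel.lt hsel.agent_notMem
  have hne : h₀ ≠ f i₀ := fun h => hsel.agent_notMem (h ▸ hsel.house_mem)
  refine ⟨fun i hi hfi => ?_, fun i hi j hj hfi hij => ?_, fun h hh => ?_, fun i hi hfi => ?_⟩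
  · by_cases h : i = i₀
    · subst h
      rw [Function.update_self]
      exact Finset.mem_erase.2 ⟨hne, hs.subset hsel.house_mem⟩
    · rw [Function.update_of_ne h] at hfi ⊢
      refine Finset.mem_erase.2 ⟨fun h' => h ?_, Finset.mem_of_mem_erase (hF.mem i hi hfi)⟩
      exact hF.inj i hi i₀ hsel.lt hfi (h'.trans hFi.symm)
  · by_cases hi' : i = i₀ <;> by_cases hj' : j = i₀
    · rw [hi', hj']
    · rw [hi', Function.update_self, Function.update_of_ne hj'] at hij
      have := hF.mem j hj (hij ▸ fun h => h0 (h ▸ hRS hsel.house_mem))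
      exact absurd hij.symm (Finset.mem_erase.1 this).1
    · rw [Function.update_of_ne hi'] at hfi
      rw [hj', Function.update_self, Function.update_of_ne hi'] at hij
      exact absurd hij (Finset.mem_erase.1 (hF.mem i hi hfi)).1
    · rw [Function.update_of_ne hi'] at hfi
      rw [Function.update_of_ne hi', Function.update_of_ne hj'] at hij
      exact hF.inj i hi j hj hfi hij
  · obtain ⟨hne', hmem⟩ := Finset.mem_erase.1 hh
    by_cases h' : h = h₀
    · exact ⟨i₀, hsel.lt, by rw [Function.update_self, h']⟩
    · obtain ⟨i, hi, rfl⟩ := hF.surj h (Finset.mem_erase.2 ⟨h', hmem⟩)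
      refine ⟨i, hi, Function.update_of_ne ?_ _ _⟩
      rintro rfl
      exact hne' hFi
  · by_cases h : i = i₀
    · subst h
      rw [Function.update_self]
      exact favourite_raise hsel
    · rw [Function.update_of_ne h] at hfi ⊢
      exact hF.tight i hi hfi

/-- The search step for a selected agent that has a house. -/
theorem extend (hs : IsSearchState n u S M r p f R F)
    (hsel : IsSelected n u S p f R δ i₀ h₀) (h0 : 0 ∉ S) (hRS : R ⊆ S) (hS : S.card = n)
    (hi₀ : f i₀ ≠ 0) :
    IsSearchState n u S M r (raise p R δ) f (insert (f i₀) R)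
      (Function.update F (f i₀) (Function.update (F h₀) i₀ h₀)) where
  lower := hs.isLowerSubsidy_raise hsel h0 hRS hS
  base := isTightMatching_raise hsel hRS hs.base fun i _ => em (f i ∈ R)
  root_mem := Finset.mem_insert_of_mem hs.root_mem
  subset := Finset.insert_subset
    (Finset.mem_insert_of_mem (hs.base.mem i₀ hsel.lt hi₀)) hs.subset
  matching h hh := by
    by_cases h' : h = f i₀
    · rw [h', Function.update_self]
      exact hs.isTightMatching_update hsel h0 hRS
    · rw [Function.update_of_ne h']
      exact hs.matching_raise hsel hRS (Finset.mem_of_mem_insert_of_ne hh h')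
  outside h hh i hi hfi := by
    rw [Finset.mem_insert, not_or] at hfi
    by_cases h' : h = f i₀
    · rw [h', Function.update_self, Function.update_of_ne (fun h => hfi.1 (by rw [h]))]
      exact hs.outside _ hsel.house_mem i hi hfi.2
    · rw [Function.update_of_ne h']
      exact hs.outside h (Finset.mem_of_mem_insert_of_ne hh h') i hi hfi.2
  inside h hh i hi hfi := by
    by_cases hi' : i = i₀
    · subst hi'
      by_cases h' : h = f i
      · rw [h', Function.update_self, Function.update_self]
        exact ⟨Finset.mem_insert_of_mem hsel.house_mem,
          fun h => hsel.agent_notMem (h ▸ hsel.house_mem)⟩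
      · rw [Function.update_of_ne h',
          hs.outside h (Finset.mem_of_mem_insert_of_ne hh h') i hi hsel.agent_notMem]
        exact ⟨hfi, Ne.symm h'⟩
    -- Only `i₀` holds the newly reached house under `f`, so any other agent counted as reached was
    -- reached before.
    · have hfiR : f i ∈ R := Finset.mem_of_mem_insert_of_ne hfi fun h =>
        hi' (hs.base.inj i₀ hsel.lt i hi hi₀ h.symm).symm
      by_cases h' : h = f i₀
      · rw [h', Function.update_self, Function.update_of_ne hi']
        have := hs.inside h₀ hsel.house_mem i hi hfiR
        exact ⟨Finset.mem_insert_of_mem this.1, fun h => hsel.agent_notMem (h ▸ this.1)⟩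
      · rw [Function.update_of_ne h']
        have := hs.inside h (Finset.mem_of_mem_insert_of_ne hh h') i hi hfiR
        exact ⟨Finset.mem_insert_of_mem this.1, this.2⟩

/-- The search step for a selected agent that has no house. -/
theorem augment (hs : IsSearchState n u S M r p f R F)
    (hsel : IsSelected n u S p f R δ i₀ h₀) (h0 : 0 ∉ S) (hM : M ⊆ S) (hr : r ∈ S)
    (hi₀ : f i₀ = 0) :
    IsTightMatching n u S (insert r M) (raise p R δ) (Function.update (F h₀) i₀ h₀) := by
  -- With `f i₀ = 0` the move vacates no house, so the updated matching covers all of `insert r M`.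
  have := hs.isTightMatching_update hsel h0 (hs.reached_subset hM hr)
  rwa [hi₀, Finset.erase_eq_of_notMem] at this
  exact fun h => h0 (Finset.insert_subset hr hM h)

/-- The root is not in `M`, so `M` has fewer than `n` houses and some agent has none; the mark `0`
is never reached. Thus a further search step is always possible. -/
theorem exists_agent_notMem (hs : IsSearchState n u S M r p f R F) (h0 : 0 ∉ S) (hM : M ⊆ S)
    (hr : r ∈ S) (hrM : r ∉ M) (hS : S.card = n) : ∃ i < n, f i ∉ R := by
  have hlt : M.card < n := hS ▸ Finset.card_lt_card
    (Finset.ssubset_iff_of_subset hM |>.2 ⟨r, hr, hrM⟩)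
  obtain ⟨i, hi, hfi⟩ := hs.base.exists_eq_zero hlt
  exact ⟨i, hi, fun h => h0 (hs.reached_subset hM hr (hfi ▸ h))⟩

/-- This limits the search: every step that does not augment enlarges `R`. -/
theorem card_reached_le (hs : IsSearchState n u S M r p f R F) (hM : M ⊆ S) (hr : r ∈ S)
    (hS : S.card = n) : R.card ≤ n :=
  hS ▸ Finset.card_le_card (hs.reached_subset hM hr)

end IsSearchState

end HungarianMethod

section Algorithm

/-! The arrays and variables that the algorithm uses. -/

local notation "arrOut" => (1 : ℕ)
local notation "varDen" => (2 : ℕ)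
local notation "arrAvail" => (3 : ℕ)
local notation "arrPrice" => (4 : ℕ)
local notation "arrHouse" => (5 : ℕ)
local notation "arrReached" => (6 : ℕ)
local notation "arrHole" => (7 : ℕ)
local notation "varDone" => (8 : ℕ)
local notation "varFound" => (9 : ℕ)
local notation "varDelta" => (10 : ℕ)
local notation "varSelAgent" => (11 : ℕ)
local notation "varSelHouse" => (12 : ℕ)
local notation "varMax" => (13 : ℕ)
local notation "varSlack" => (14 : ℕ)
local notation "varTotal" => (15 : ℕ)
local notation "varBest" => (16 : ℕ)
local notation "varSolved" => (17 : ℕ)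
local notation "varI" => (18 : ℕ)
local notation "varH" => (19 : ℕ)
local notation "varRoot" => (20 : ℕ)
local notation "varRound" => (21 : ℕ)

open Code

/-! ### One search step as a program -/

section SearchStep

/-- The number of agents. -/
def agents : Expr := .load 0 1

/-- The position of the utility of agent `i` for house `h` among the entries of the input. -/
def position (i h : Expr) : Expr := i * .load 0 2 + h

/-- The utility of agent `i` for house `h`, multiplied by the common denominator. -/
def utility (i h : Expr) : Expr :=
  (var varDen / .load 0 (position i h + position i h + 2)) *
    .load 0 (position i h + position i h + 1)

/-- The number of the house that the loop with counter `varH` considers. -/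
def houseH : Expr := var varH + 1

/-- The utility of agent `varI` for the current house, plus the subsidy of the house. -/
def valueH : Expr := utility (var varI) houseH + .load arrPrice houseH

/-- The largest value of an available house for agent `varI`. -/
def computeMax : Code :=
  seq (assign varMax 0) (count varH 2 (cond (.load arrAvail houseH)
    (cond (valueH - var varMax) (assign varMax valueH))))

/-- Record the current agent and house. -/
def record : Code :=
  seq (seq (assign varDelta (var varSlack)) (assign varSelAgent (var varI)))
    (seq (assign varSelHouse houseH) (assign varFound 1))

/-- Record the current agent and house if their slack is smaller than the recorded one. -/
def compareSlack : Code :=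
  seq (cond (1 - var varFound) record) (cond (var varDelta - var varSlack) record)

/-- Compare the slacks of agent `varI` for all reached houses. -/
def compareSlacks : Code :=
  count varH 2 (cond (.load arrReached houseH)
    (seq (assign varSlack (var varMax - valueH)) compareSlack))

/-- Select an agent that has not been reached, and a reached house, of smallest slack. -/
def select : Code :=
  seq (assign varFound 0) (count varI 1 (cond (1 - .load arrReached (.load arrHouse (var varI)))
    (seq computeMax compareSlacks)))

/-- Raise the subsidies of reached houses. -/
def raisePrices : Code :=
  count varH 2 (cond (.load arrReached houseH)
    (store arrPrice houseH (.load arrPrice houseH + var varDelta)))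

/-- The house of the selected agent. -/
def selectedOld : Expr := .load arrHouse (var varSelAgent)

/-- The matching in which the selected agent moves to the selected house. -/
def moveSelected : Code :=
  seq (count varI 1 (store arrHole (selectedOld * agents + var varI)
      (.load arrHole (var varSelHouse * agents + var varI))))
    (store arrHole (selectedOld * agents + var varSelAgent) (var varSelHouse))

/-- Adopt the matching stored in row `0`. -/
def adopt : Code := count varI 1 (store arrHouse (var varI) (.load arrHole (var varI)))

/-- One step of the search for an augmenting path. -/
def searchStep : Code :=
  seq (seq select raisePrices) (seq moveSelected
    (ite selectedOld (store arrReached selectedOld 1) (seq (assign varDone 1) adopt)))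

/-- The memory holds an instance with `n` agents and `m` houses, and `u` gives the utilities,
multiplied by the number in `varDen`. -/
structure HoldsInstance (n m : ℕ) (u : ℕ → ℕ → ℤ) (σ : Mem) : Prop where
  agents_eq : σ 0 1 = n
  houses_eq : σ 0 2 = m
  utility_eq : ∀ i h : ℕ, u i h =
    σ varDen 0 / σ 0 (2 * (i * m + h) + 2) * σ 0 (2 * (i * m + h) + 1)
  nonneg : ∀ i < n, ∀ h ∈ Finset.Icc 1 m, 0 ≤ u i h

/-- The array `arrAvail` marks the houses in `S`. -/
structure HoldsAvailable (m : ℕ) (S : Finset ℕ) (σ : Mem) : Prop where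
  subset : S ⊆ Finset.Icc 1 m
  iff : ∀ h ∈ Finset.Icc 1 m, 0 < σ arrAvail h ↔ h ∈ S

variable {n m : ℕ} {u : ℕ → ℕ → ℤ} {S M R : Finset ℕ} {σ τ : Mem} {r : ℕ} {f : ℕ → ℕ}
  {F : ℕ → ℕ → ℕ}

theorem HoldsInstance.congr (h : HoldsInstance n m u σ) (h₀ : τ 0 = σ 0)
    (h₁ : τ varDen = σ varDen) : HoldsInstance n m u τ where
  agents_eq := by rw [h₀, h.agents_eq]
  houses_eq := by rw [h₀, h.houses_eq]
  utility_eq i k := by rw [h₀, h₁, h.utility_eq]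
  nonneg := h.nonneg

theorem HoldsAvailable.congr (h : HoldsAvailable m S σ) (h₁ : τ arrAvail = σ arrAvail) :
    HoldsAvailable m S τ :=
  ⟨h.subset, by rw [h₁]; exact h.iff⟩

theorem HoldsAvailable.zero_notMem (h : HoldsAvailable m S σ) : 0 ∉ S := fun h0 => by
  simpa using h.subset h0

theorem HoldsAvailable.iff_succ (h : HoldsAvailable m S σ) {k : ℕ} (hk : k < m) :
    0 < σ arrAvail (k + 1) ↔ k + 1 ∈ S :=
  h.iff (k + 1) (by simp; omega)

theorem eval_houseH {k : ℕ} (hk : σ varH 0 = k) : houseH.eval σ = ((k + 1 : ℕ) : ℤ) := by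
  simp [houseH, hk]

/-- Three cells (length, `n`, `m`) precede the utilities and houses are counted from `1`, so the
numerator is in cell `2 * (i * m + (k - 1)) + 3 = 2 * (i * m + k) + 1` and the denominator in the
next one. -/
theorem HoldsInstance.eval_utility (h : HoldsInstance n m u σ) {i k : ℕ} {e e' : Expr}
    (he : e.eval σ = i) (he' : e'.eval σ = k) : (utility e e').eval σ = u i k := by
  have h₁ : ((i : ℤ) * m + k + (i * m + k) + 2).toNat = 2 * (i * m + k) + 2 := by
    rw [show (i : ℤ) * m + k + (i * m + k) + 2 = ((2 * (i * m + k) + 2 : ℕ) : ℤ) by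
      push_cast; ring, Int.toNat_natCast]
  have h₂ : ((i : ℤ) * m + k + (i * m + k) + 1).toNat = 2 * (i * m + k) + 1 := by
    rw [show (i : ℤ) * m + k + (i * m + k) + 1 = ((2 * (i * m + k) + 1 : ℕ) : ℤ) by
      push_cast; ring, Int.toNat_natCast]
  simp [utility, position, he, he', h.houses_eq, h.utility_eq, h₁, h₂]

theorem HoldsInstance.eval_valueH (h : HoldsInstance n m u σ) {i k : ℕ} (hi : σ varI 0 = i)
    (hk : σ varH 0 = k) : valueH.eval σ = u i (k + 1) + σ arrPrice (k + 1) := by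
  have := h.eval_utility (e := var varI) hi (eval_houseH hk)
  simp only [valueH, Expr.eval_add, this, Expr.eval_load, eval_houseH hk, Int.toNat_natCast]

/-- Starting the maximum at `0` is harmless: utilities and prices are nonnegative, so the true
maximum is too. -/
theorem run_computeMax (h : HoldsInstance n m u σ) (hS : HoldsAvailable m S σ) {i : ℕ}
    (hi : σ varI 0 = i) (hin : i < n) (hp : ∀ k ∈ S, 0 ≤ σ arrPrice k) {v : ℤ}
    (hv : ∀ k ∈ S, u i k + σ arrPrice k ≤ v) (hv' : ∃ k ∈ S, u i k + σ arrPrice k = v) :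
    computeMax.run σ varMax 0 = v := by
  have key := count_induction (σ := σ.set varMax 0 0) (v := varH) (k := 2) (N := m)
    (P := cond (.load arrAvail houseH) (cond (valueH - var varMax) (assign varMax valueH)))
    (by simp [h.houses_eq])
    (fun j τ => (∀ k ∈ S, k ≤ j → u i k + σ arrPrice k ≤ τ varMax 0) ∧
      (τ varMax 0 = 0 ∨ ∃ k ∈ S, u i k + σ arrPrice k = τ varMax 0)) ?_ ?_
  · obtain ⟨h₁, h₂⟩ := key
    change (_ : ℤ) = v at *
    have hle : v ≤ computeMax.run σ varMax 0 := by
      obtain ⟨k, hk, rfl⟩ := hv'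
      exact h₁ k hk (Finset.mem_Icc.1 (hS.subset hk)).2
    rcases h₂ with h₂ | ⟨k, hk, h₂⟩
    · obtain ⟨k, hk, rfl⟩ := hv'
      have h₃ := h.nonneg i hin k (hS.subset hk)
      have h₄ := hp k hk
      have h₅ : computeMax.run σ varMax 0 = 0 := h₂
      omega
    · have h₃ := hv k hk
      have h₅ : u i k + σ arrPrice k = computeMax.run σ varMax 0 := h₂
      omega
  · refine ⟨fun k hk hk0 => ?_, by simp⟩
    have := Finset.mem_Icc.1 (hS.subset hk)
    omega
  · rintro j τ hj hτ hfr ⟨h₁, h₂⟩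
    have fr : ∀ a, a ≠ varMax → a ≠ varH → τ a = σ a := fun a h₁ h₂ => by
      rw [hfr a (by simp [writes, h₁, h₂]), Mem.set_of_ne _ _ _ h₁]
    have e₁ := (h.congr (τ := τ) (fr _ (by decide) (by decide))
      (fr _ (by decide) (by decide))).eval_valueH (by rw [fr varI (by decide) (by decide), hi]) hτ
    rw [fr arrPrice (by decide) (by decide)] at e₁
    have e₂ : (Expr.load arrAvail houseH).eval τ = σ arrAvail (j + 1) := by
      rw [Expr.eval_load, eval_houseH hτ, fr arrAvail (by decide) (by decide), Int.toNat_natCast]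
    have hsucc : ∀ k, k ≤ j + 1 ↔ k ≤ j ∨ k = j + 1 := by omega
    simp only [run, e₁, e₂, Expr.eval_sub, eval_var, hS.iff_succ hj, Expr.eval_zero]
    split
    · next hjS =>
      split
      · refine ⟨fun k hk hkj => ?_, Or.inr ⟨j + 1, hjS, by simp⟩⟩
        simp
        rcases (hsucc k).1 hkj with h' | rfl
        · have := h₁ k hk h'
          omega
        · exact le_rfl
      · refine ⟨fun k hk hkj => ?_, by simpa using h₂⟩
        simp
        rcases (hsucc k).1 hkj with h' | rfl
        · exact h₁ k hk h'
        · omega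
    · next hjS =>
      refine ⟨fun k hk hkj => ?_, by simpa using h₂⟩
      simp
      rcases (hsucc k).1 hkj with h' | rfl
      · exact h₁ k hk h'
      · exact absurd hk hjS

/-- Among the pairs of an agent and a house that satisfy `C`, one of smallest slack is
recorded. -/
def HoldsSmallest (slack : ℕ → ℕ → ℤ) (C : ℕ → ℕ → Prop) (σ : Mem) : Prop :=
  (σ varFound 0 = 0 ∧ ∀ i k, ¬ C i k) ∨
    (σ varFound 0 = 1 ∧ ∃ i k : ℕ, C i k ∧ σ varSelAgent 0 = i ∧ σ varSelHouse 0 = k ∧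
      σ varDelta 0 = slack i k ∧ ∀ i' k', C i' k' → slack i k ≤ slack i' k')

variable {slack : ℕ → ℕ → ℤ} {C C' : ℕ → ℕ → Prop}

theorem HoldsSmallest.congr (h : HoldsSmallest slack C σ) (hC : ∀ i k, C' i k ↔ C i k)
    (h₁ : τ varFound = σ varFound) (h₂ : τ varSelAgent = σ varSelAgent)
    (h₃ : τ varSelHouse = σ varSelHouse) (h₄ : τ varDelta = σ varDelta) :
    HoldsSmallest slack C' τ := by
  simpa only [HoldsSmallest, hC, h₁, h₂, h₃, h₄] using h

/-- If nothing was recorded, the first test records the pair and the second then compares its slack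
with itself. Otherwise only the second test can act. -/
theorem HoldsSmallest.run_compareSlack (h : HoldsSmallest slack C σ) {i k : ℕ}
    (hi : σ varI 0 = i) (hk : σ varH 0 = k) (hs : σ varSlack 0 = slack i (k + 1))
    (hC : ∀ i' k', C' i' k' ↔ C i' k' ∨ i' = i ∧ k' = k + 1) :
    HoldsSmallest slack C' (compareSlack.run σ) := by
  simp only [HoldsSmallest, hC]
  rcases h with ⟨h₁, h₂⟩ | ⟨h₁, i', k', h₂, h₃, h₄, h₅, h₆⟩
  · right
    simp [compareSlack, record, run, h₁, h₂, houseH, hi, hk, hs]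
  · right
    have hrun : compareSlack.run σ = (cond (var varDelta - var varSlack) record).run σ :=
      congrArg _ (run_ite_neg (by simp [h₁]) _ _)
    rw [hrun]
    by_cases hlt : 0 < (var varDelta - var varSlack).eval σ
    · rw [run_ite_pos hlt]
      simp only [Expr.eval_sub, eval_var, h₅, hs] at hlt
      refine ⟨by simp [record, run], i, k + 1, Or.inr ⟨rfl, rfl⟩, by simp [record, run, hi],
        by simp [record, run, houseH, hk], by simp [record, run, hs], ?_⟩
      rintro i'' k'' (h | ⟨rfl, rfl⟩)
      · have := h₆ _ _ h
        omega
      · exact le_rfl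
    · rw [run_ite_neg hlt]
      simp only [Expr.eval_sub, eval_var, h₅, hs] at hlt
      refine ⟨h₁, i', k', Or.inl h₂, h₃, h₄, h₅, ?_⟩
      rintro i'' k'' (h | ⟨rfl, rfl⟩)
      · exact h₆ _ _ h
      · omega

theorem HoldsSmallest.run_compareSlacks (h : HoldsSmallest slack C σ)
    (hinst : HoldsInstance n m u σ) {i : ℕ} (hi : σ varI 0 = i)
    (hR : ∀ k ≤ m, 0 < σ arrReached k ↔ k ∈ R) (hRm : R ⊆ Finset.Icc 1 m)
    (hs : ∀ k, slack i k = σ varMax 0 - (u i k + σ arrPrice k))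
    (hC : ∀ i' k', C' i' k' ↔ C i' k' ∨ i' = i ∧ k' ∈ R) :
    HoldsSmallest slack C' (compareSlacks.run σ) := by
  have key := count_induction (σ := σ) (v := varH) (k := 2) (N := m)
    (P := cond (.load arrReached houseH) (seq (assign varSlack (var varMax - valueH))
      compareSlack)) hinst.houses_eq
    (fun j τ => HoldsSmallest slack (fun i' k' => C i' k' ∨ i' = i ∧ k' ∈ R ∧ k' ≤ j) τ) ?_ ?_
  · refine key.congr (fun i' k' => ?_) rfl rfl rfl rfl
    rw [hC]
    have : k' ∈ R → k' ≤ m := fun h => (Finset.mem_Icc.1 (hRm h)).2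
    tauto
  · refine h.congr (fun i' k' => ?_) rfl rfl rfl rfl
    have : k' ∈ R → 1 ≤ k' := fun h => (Finset.mem_Icc.1 (hRm h)).1
    constructor
    · rintro (h | ⟨-, h₁, h₂⟩)
      · exact h
      · have := this h₁
        omega
    · exact Or.inl
  · intro j τ hj hτ hfr h
    -- The numerals are array numbers; the list contains every array that the loop writes.
    have fr : ∀ a, a ∉ [8, 9, 10, 11, 12, 14, 19] → τ a = σ a := fun a ha => by
      refine hfr a ?_
      simp only [List.mem_cons, not_or] at ha
      simp [writes, compareSlack, record, ha]
    have e₁ := (hinst.congr (τ := τ) (fr _ (by decide))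
      (fr _ (by decide))).eval_valueH (by rw [fr varI (by decide), hi]) hτ
    rw [fr arrPrice (by decide)] at e₁
    have e₂ : (Expr.load arrReached houseH).eval τ = σ arrReached (j + 1) := by
      rw [Expr.eval_load, eval_houseH hτ, fr arrReached (by decide), Int.toNat_natCast]
    have hsucc : ∀ k, k ≤ j + 1 ↔ k ≤ j ∨ k = j + 1 := by omega
    rw [run, e₂]
    simp only [hR (j + 1) hj]
    split
    · next hjR =>
      have hrun : HoldsSmallest slack (fun i' k' => C i' k' ∨ i' = i ∧ k' ∈ R ∧ k' ≤ j + 1)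
          ((seq (assign varSlack (var varMax - valueH)) compareSlack).run τ) := by
        rw [run_seq]
        refine HoldsSmallest.run_compareSlack (i := i) (k := j)
          (h.congr (τ := (assign varSlack (var varMax - valueH)).run τ) (fun _ _ => Iff.rfl)
            rfl rfl rfl rfl) ?_ ?_ ?_ ?_
        · simp [run, fr varI (by decide), hi]
        · simp [run, hτ]
        · simp [run, e₁, hs, fr varMax (by decide)]
        · intro i' k'
          rw [hsucc]
          constructor
          · rintro (h | ⟨h₁, h₂, h₃ | h₃⟩) <;> tauto
          · rintro (h | ⟨h₁, rfl⟩) <;> tauto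
      exact hrun.congr (fun _ _ => Iff.rfl) (Mem.set_of_ne _ _ _ (by decide))
        (Mem.set_of_ne _ _ _ (by decide)) (Mem.set_of_ne _ _ _ (by decide))
        (Mem.set_of_ne _ _ _ (by decide))
    · next hjR =>
      refine h.congr (fun i' k' => ?_) (Mem.set_of_ne _ _ _ (by decide))
        (Mem.set_of_ne _ _ _ (by decide)) (Mem.set_of_ne _ _ _ (by decide))
        (Mem.set_of_ne _ _ _ (by decide))
      rw [hsucc]
      constructor
      · rintro (h | ⟨h₁, h₂, h₃ | rfl⟩) <;> tauto
      · tauto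

/-- The memory holds the flags of the reached houses and the matchings of a search. -/
structure HoldsSearch (n m : ℕ) (f : ℕ → ℕ) (R : Finset ℕ) (F : ℕ → ℕ → ℕ) (σ : Mem) : Prop where
  house_eq : ∀ i < n, σ arrHouse i = f i
  house_le : ∀ i < n, f i ≤ m
  reached_iff : ∀ k ≤ m, 0 < σ arrReached k ↔ k ∈ R
  hole_eq : ∀ h ∈ R, ∀ i < n, σ arrHole (h * n + i) = F h i

/-- With `v i` the best value for agent `i`, the slack of `(i, k)` is the raise of `k` that makes it
a favourite of `i`. The recorded pair has least slack: `favourite` holds because `v i₀` is an upper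
bound, `slack` because `v i` is attained. -/
theorem run_select (hinst : HoldsInstance n m u σ) (hS : HoldsAvailable m S σ)
    (hσ : HoldsSearch n m f R F σ) (hRS : R ⊆ S) (hR : R.Nonempty) (hex : ∃ i < n, f i ∉ R)
    (hp : ∀ k ∈ S, 0 ≤ σ arrPrice k) :
    ∃ i₀ h₀ : ℕ, select.run σ varSelAgent 0 = i₀ ∧ select.run σ varSelHouse 0 = h₀ ∧
      IsSelected n u S (σ arrPrice) f R (select.run σ varDelta 0) i₀ h₀ := by
  have hmax : ∀ i, ∃ v, (∀ k ∈ S, u i k + σ arrPrice k ≤ v) ∧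
      ∃ k ∈ S, u i k + σ arrPrice k = v := by
    intro i
    obtain ⟨k, hk, hle⟩ := S.exists_max_image (fun k => u i k + σ arrPrice k) (hR.mono hRS)
    exact ⟨_, hle, k, hk, rfl⟩
  choose v hv hv' using hmax
  have key := count_induction (σ := σ.set varFound 0 0) (v := varI) (k := 1) (N := n)
    (P := cond (1 - .load arrReached (.load arrHouse (var varI))) (seq computeMax compareSlacks))
    (by simp [hinst.agents_eq])
    (fun j τ => HoldsSmallest (fun i k => v i - (u i k + σ arrPrice k))
      (fun i k => i < j ∧ f i ∉ R ∧ k ∈ R) τ) ?_ ?_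
  · rcases key with ⟨-, h⟩ | ⟨-, i₀, h₀, ⟨h₁, h₂, h₃⟩, h₄, h₅, h₆, h₇⟩
    · obtain ⟨i, hi, hfi⟩ := hex
      obtain ⟨k, hk⟩ := hR
      exact absurd ⟨hi, hfi, hk⟩ (h i k)
    · have h₆ : select.run σ varDelta 0 = v i₀ - (u i₀ h₀ + σ arrPrice h₀) := h₆
      refine ⟨i₀, h₀, h₄, h₅, h₁, h₂, h₃, fun h hh => ?_, fun i hi hfi h hh => ?_⟩
      · have := hv i₀ h hh
        omega
      · obtain ⟨k, hk, hk'⟩ := hv' i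
        refine ⟨k, hk, ?_⟩
        have : v i₀ - (u i₀ h₀ + σ arrPrice h₀) ≤ v i - (u i h + σ arrPrice h) :=
          h₇ i h ⟨hi, hfi, hh⟩
        omega
  · exact Or.inl ⟨by simp, by simp⟩
  · intro j τ hj hτ hfr h
    have fr : ∀ a, a ∉ [8, 9, 10, 11, 12, 13, 14, 18, 19] → τ a = σ a := fun a ha => by
      simp only [List.mem_cons, not_or] at ha
      rw [hfr a (by simp [writes, computeMax, compareSlacks, compareSlack, record, ha]),
        Mem.set_of_ne _ _ _ ha.2.1]
    have hinst' := hinst.congr (fr 0 (by decide)) (fr varDen (by decide))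
    have e₁ : (1 - Expr.load arrReached (.load arrHouse (var varI))).eval τ =
        1 - σ arrReached (f j) := by
      simp [hτ, fr arrReached (by decide), fr arrHouse (by decide), hσ.house_eq j hj]
    have e₂ : 0 < 1 - σ arrReached (f j) ↔ f j ∉ R := by
      rw [← hσ.reached_iff _ (hσ.house_le j hj)]
      omega
    have hlt : ∀ i, i < j + 1 ↔ i < j ∨ i = j := by omega
    by_cases hjR : f j ∈ R
    · rw [run_ite_neg (by rw [e₁, e₂]; exact not_not.2 hjR)]
      refine h.congr (fun i k => ?_) (Mem.set_of_ne _ _ _ (by decide))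
        (Mem.set_of_ne _ _ _ (by decide)) (Mem.set_of_ne _ _ _ (by decide))
        (Mem.set_of_ne _ _ _ (by decide))
      rw [hlt]
      constructor
      · rintro ⟨h₁ | rfl, h₂, h₃⟩ <;> tauto
      · tauto
    · rw [run_ite_pos (by rwa [e₁, e₂]), run_seq]
      have fr' : ∀ a, a ≠ varMax → a ≠ varH → computeMax.run τ a = τ a := fun a h₁ h₂ =>
        run_of_notMem_writes _ _ (by simp [writes, computeMax, h₁, h₂])
      have hmax := run_computeMax hinst' (hS.congr (fr _ (by decide))) hτ hj
        (by rwa [fr arrPrice (by decide)]) (v := v j)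
        (by rw [fr arrPrice (by decide)]; exact hv j)
        (by rw [fr arrPrice (by decide)]; exact hv' j)
      have h' := (h.congr (fun _ _ => Iff.rfl) (fr' _ (by decide) (by decide))
        (fr' _ (by decide) (by decide)) (fr' _ (by decide) (by decide))
        (fr' _ (by decide) (by decide))).run_compareSlacks (R := R) (i := j)
        (hinst'.congr (fr' _ (by decide) (by decide)) (fr' _ (by decide) (by decide)))
        (by rw [fr' varI (by decide) (by decide), hτ])
        (by rw [fr' arrReached (by decide) (by decide), fr arrReached (by decide)]
            exact hσ.reached_iff)
        (hRS.trans hS.subset)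
        (by rw [hmax, fr' arrPrice (by decide) (by decide), fr arrPrice (by decide)]
            exact fun _ => rfl)
        (fun _ _ => Iff.rfl)
      refine h'.congr (fun i k => ?_) (Mem.set_of_ne _ _ _ (by decide))
        (Mem.set_of_ne _ _ _ (by decide)) (Mem.set_of_ne _ _ _ (by decide))
        (Mem.set_of_ne _ _ _ (by decide))
      rw [hlt]
      constructor
      · rintro ⟨h₁ | rfl, h₂, h₃⟩ <;> tauto
      · rintro (h | ⟨rfl, h⟩) <;> tauto

theorem run_raisePrices (hinst : HoldsInstance n m u σ)
    (hR : ∀ k ≤ m, 0 < σ arrReached k ↔ k ∈ R) (hRm : R ⊆ Finset.Icc 1 m) :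
    raisePrices.run σ arrPrice = raise (σ arrPrice) R (σ varDelta 0) := by
  have key := count_induction (σ := σ) (v := varH) (k := 2) (N := m)
    (P := cond (.load arrReached houseH)
      (store arrPrice houseH (.load arrPrice houseH + var varDelta))) hinst.houses_eq
    (fun j τ => ∀ k, τ arrPrice k =
      if k ∈ R ∧ k ≤ j then σ arrPrice k + σ varDelta 0 else σ arrPrice k) ?_ ?_
  · funext k
    refine (key k).trans ?_
    have : k ∈ R → k ≤ m := fun h => (Finset.mem_Icc.1 (hRm h)).2
    simp only [raise]
    congr 1
    simpa using this
  · intro k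
    have : k ∈ R → 1 ≤ k := fun h => (Finset.mem_Icc.1 (hRm h)).1
    rw [if_neg (by rintro ⟨h₁, h₂⟩; have := this h₁; omega)]
    simp
  · intro j τ hj hτ hfr h k
    have fr : ∀ a, a ∉ [4, 19] → τ a = σ a := fun a ha => by
      refine hfr a ?_
      simp only [List.mem_cons, not_or] at ha
      simp [writes, ha]
    have e : (Expr.load arrReached houseH).eval τ = σ arrReached (j + 1) := by
      rw [Expr.eval_load, eval_houseH hτ, fr arrReached (by decide), Int.toNat_natCast]
    rw [Mem.set_of_ne _ _ _ (by decide)]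
    by_cases hjR : j + 1 ∈ R
    · rw [run_ite_pos (by rwa [e, hR _ hj]), run]
      simp only [eval_houseH hτ, Int.toNat_natCast, Expr.eval_add, Expr.eval_load, eval_var,
        fr varDelta (by decide), Mem.set_same, h]
      by_cases hk : k = j + 1
      · subst hk
        simp [hjR]
      · have : k ≤ j + 1 ↔ k ≤ j := by omega
        simp only [hk, if_false, this]
    · rw [run_ite_neg (by rwa [e, hR _ hj]), run, h]
      congr 1
      rw [eq_iff_iff, and_congr_right_iff]
      intro hk
      have : k ≠ j + 1 := by rintro rfl; exact hjR hk
      omega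

/-- The matching `F h` is stored as row `h`, of length `n`, of one array; division with remainder by
`n` separates the rows. -/
theorem row_eq_iff {h h' i i' : ℕ} (hi : i < n) (hi' : i' < n) :
    h * n + i = h' * n + i' ↔ h = h' ∧ i = i' := by
  refine ⟨fun heq => ?_, fun ⟨h₁, h₂⟩ => by rw [h₁, h₂]⟩
  have hn : 0 < n := by omega
  have h₁ := congrArg (· / n) heq
  have h₂ := congrArg (· % n) heq
  simp only [mul_comm _ n, Nat.mul_add_div hn, Nat.mul_add_mod, Nat.div_eq_of_lt, hi, hi',
    Nat.mod_eq_of_lt] at h₁ h₂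
  exact ⟨by simpa using h₁, h₂⟩

/-- Row `h₀` is copied to row `h₁` before the entry of `i₀` is replaced. Since `h₀ ≠ h₁`, the
copying never overwrites the row being read. -/
theorem run_moveSelected (hinst : HoldsInstance n m u σ) {i₀ h₀ h₁ : ℕ}
    (hi₀ : σ varSelAgent 0 = i₀) (hh₀ : σ varSelHouse 0 = h₀) (hf : σ arrHouse i₀ = h₁)
    (hne : h₀ ≠ h₁) (hi₀n : i₀ < n) (h i : ℕ) (hi : i < n) :
    moveSelected.run σ arrHole (h * n + i) =
      if h = h₁ then if i = i₀ then (h₀ : ℤ) else σ arrHole (h₀ * n + i)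
      else σ arrHole (h * n + i) := by
  set P := store arrHole (selectedOld * agents + var varI)
      (.load arrHole (var varSelHouse * agents + var varI)) with hP
  have key := count_induction (σ := σ) (v := varI) (k := 1) (N := n)
    (P := P) hinst.agents_eq
    (fun j τ => ∀ h i, i < n → τ arrHole (h * n + i) =
      if h = h₁ ∧ i < j then σ arrHole (h₀ * n + i) else σ arrHole (h * n + i)) ?_ ?_
  · have fr : ∀ a, a ≠ arrHole → a ≠ varI → (count varI 1 P).run σ a = σ a := fun a h₁ h₂ =>
      run_of_notMem_writes _ _ (by simp [writes, hP, h₁, h₂])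
    have e : ∀ a b : ℕ, ((a : ℤ) * n + b).toNat = a * n + b := fun a b => by
      rw [show (a : ℤ) * n + b = ((a * n + b : ℕ) : ℤ) by push_cast; rfl, Int.toNat_natCast]
    have hrun : moveSelected.run σ = (store arrHole (selectedOld * agents + var varSelAgent)
      (var varSelHouse)).run ((count varI 1 P).run σ) := rfl
    generalize (count varI 1 P).run σ = τ at hrun key fr
    rw [hrun, run]
    simp only [selectedOld, agents, Expr.eval_add, Expr.eval_mul, Expr.eval_load, eval_var,
      Expr.eval_one, fr varSelAgent (by decide) (by decide), fr 0 (by decide) (by decide),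
      fr varSelHouse (by decide) (by decide), fr arrHouse (by decide) (by decide), hi₀, hh₀,
      Int.toNat_natCast, hf, Int.toNat_one, hinst.agents_eq, e, Mem.set_same,
      row_eq_iff hi hi₀n, key h i hi]
    by_cases h' : h = h₁ <;> by_cases h'' : i = i₀ <;> simp [h', h'', hi]
  · intro h i hi
    simp
  · intro j τ hj hτ hfr hI h i hi
    have fr : ∀ a, a ≠ arrHole → a ≠ varI → τ a = σ a := fun a h₁ h₂ =>
      hfr a (by simp [writes, hP, h₁, h₂])
    have e : ∀ a b : ℕ, ((a : ℤ) * n + b).toNat = a * n + b := fun a b => by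
      rw [show (a : ℤ) * n + b = ((a * n + b : ℕ) : ℤ) by push_cast; rfl, Int.toNat_natCast]
    rw [Mem.set_of_ne _ _ _ (by decide), hP, run]
    simp only [selectedOld, agents, Expr.eval_add, Expr.eval_mul, Expr.eval_load, eval_var,
      Expr.eval_one, fr varSelAgent (by decide) (by decide), fr 0 (by decide) (by decide),
      fr varSelHouse (by decide) (by decide), fr arrHouse (by decide) (by decide), hi₀, hh₀,
      Int.toNat_natCast, hf, Int.toNat_one, hinst.agents_eq, hτ, e, Mem.set_same,
      row_eq_iff hi hj, hI h i hi, hI h₀ j hj, hne, false_and, if_false]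
    by_cases h' : h = h₁ <;> by_cases h'' : i = j
    · simp [h', h'']
    · have : i < j + 1 ↔ i < j := by omega
      simp [h', h'', this]
    · simp [h']
    · simp [h']

theorem run_adopt (hinst : HoldsInstance n m u σ) :
    ∀ i < n, adopt.run σ arrHouse i = σ arrHole i := by
  have key := count_induction (σ := σ) (v := varI) (k := 1) (N := n)
    (P := store arrHouse (var varI) (.load arrHole (var varI))) hinst.agents_eq
    (fun j τ => ∀ i < j, τ arrHouse i = σ arrHole i) (by simp) ?_
  · exact key
  · intro j τ hj hτ hfr hI i hi
    rw [Mem.set_of_ne _ _ _ (by decide), run]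
    simp only [Expr.eval_load, eval_var, hτ, Int.toNat_natCast, Mem.set_same,
      hfr arrHole (by decide)]
    split
    · next h => rw [h]
    · exact hI i (by omega)

/-- Progress of the search: either one more house is reached, or the matching has been augmented and
`varDone` is set. -/
theorem run_searchStep (hinst : HoldsInstance n m u σ) (hS : HoldsAvailable m S σ)
    (hσ : HoldsSearch n m f R F σ) (hs : IsSearchState n u S M r (σ arrPrice) f R F)
    (hcard : S.card = n) (hM : M ⊆ S) (hr : r ∈ S) (hrM : r ∉ M) (hdone : σ varDone 0 = 0) :
    (searchStep.run σ varDone 0 = 0 ∧ ∃ R' F', R'.card = R.card + 1 ∧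
      HoldsSearch n m f R' F' (searchStep.run σ) ∧
      IsSearchState n u S M r (searchStep.run σ arrPrice) f R' F') ∨
    (searchStep.run σ varDone 0 = 1 ∧ ∃ f', (∀ i < n, searchStep.run σ arrHouse i = f' i) ∧
      IsLowerSubsidy n u S (searchStep.run σ arrPrice) ∧
      IsTightMatching n u S (insert r M) (searchStep.run σ arrPrice) f') := by
  have hRS := hs.reached_subset hM hr
  have h0 := hS.zero_notMem
  obtain ⟨i₀, h₀, hi₀, hh₀, hsel⟩ := run_select hinst hS hσ hRS ⟨r, hs.root_mem⟩
    (hs.exists_agent_notMem h0 hM hr hrM hcard) hs.lower.nonneg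
  have frS : ∀ a, a ∉ select.writes → select.run σ a = σ a :=
    fun a ha => run_of_notMem_writes _ _ ha
  have frP : ∀ a, a ∉ raisePrices.writes →
      raisePrices.run (select.run σ) a = select.run σ a :=
    fun a ha => run_of_notMem_writes _ _ ha
  have hpr := run_raisePrices (σ := select.run σ) (R := R)
    (hinst.congr (frS _ (by decide)) (frS _ (by decide)))
    (by rw [frS arrReached (by decide)]; exact hσ.reached_iff) (hRS.trans hS.subset)
  rw [frS arrPrice (by decide)] at hpr
  set σ₂ := raisePrices.run (select.run σ) with hσ₂
  have fr₂ : ∀ a, a ∉ select.writes → a ∉ raisePrices.writes → σ₂ a = σ a :=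
    fun a h₁ h₂ => (frP a h₂).trans (frS a h₁)
  have hinst₂ : HoldsInstance n m u σ₂ :=
    hinst.congr (fr₂ _ (by decide) (by decide)) (fr₂ _ (by decide) (by decide))
  have hf₀ : σ₂ arrHouse i₀ = f i₀ := by
    rw [fr₂ _ (by decide) (by decide), hσ.house_eq i₀ hsel.lt]
  have hi₂ : σ₂ varSelAgent 0 = i₀ := by rw [frP _ (by decide), hi₀]
  have hh₂ : σ₂ varSelHouse 0 = h₀ := by rw [frP _ (by decide), hh₀]
  have hmove := run_moveSelected hinst₂ hi₂ hh₂ hf₀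
    (fun h => hsel.agent_notMem (h ▸ hsel.house_mem)) hsel.lt
  have frM : ∀ a, a ∉ moveSelected.writes → moveSelected.run σ₂ a = σ₂ a :=
    fun a ha => run_of_notMem_writes _ _ ha
  set σ₃ := moveSelected.run σ₂ with hσ₃
  have fr₃ : ∀ a, a ∉ select.writes → a ∉ raisePrices.writes → a ∉ moveSelected.writes →
      σ₃ a = σ a := fun a h₁ h₂ h₃ => (frM a h₃).trans (fr₂ a h₁ h₂)
  have hrow : ∀ i < n, σ₃ arrHole (f i₀ * n + i) =
      ((Function.update (F h₀) i₀ h₀ i : ℕ) : ℤ) := by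
    intro i hi
    rw [hmove _ _ hi, if_pos rfl]
    by_cases h : i = i₀
    · rw [if_pos h, h, Function.update_self]
    · rw [if_neg h, Function.update_of_ne h, fr₂ _ (by decide) (by decide),
        hσ.hole_eq _ hsel.house_mem i hi]
  have hold : selectedOld.eval σ₃ = f i₀ := by
    simp [selectedOld, frM varSelAgent (by decide), frM arrHouse (by decide), hi₂, hf₀]
  have hp₃ : σ₃ arrPrice = raise (σ arrPrice) R (select.run σ varDelta 0) := by
    rw [frM _ (by decide), hpr]
  have hrun : searchStep.run σ = (ite selectedOld (store arrReached selectedOld 1)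
      (seq (assign varDone 1) adopt)).run σ₃ := rfl
  rw [hrun]
  by_cases hfi₀ : f i₀ = 0
  · right
    rw [run_ite_neg (by rw [hold, hfi₀]; simp), run_seq]
    set σ₄ := (assign varDone 1).run σ₃ with hσ₄
    have fr₄ : ∀ a, a ≠ varDone → σ₄ a = σ₃ a := fun a h => Mem.set_of_ne _ _ _ h
    have frA : ∀ a, a ∉ adopt.writes → adopt.run σ₄ a = σ₄ a :=
      fun a ha => run_of_notMem_writes _ _ ha
    have hadopt := run_adopt (σ := σ₄) (n := n) (m := m) (u := u) (hinst₂.congr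
      ((fr₄ 0 (by decide)).trans (frM _ (by decide)))
      ((fr₄ varDen (by decide)).trans (frM _ (by decide))))
    refine ⟨?_, Function.update (F h₀) i₀ h₀, fun i hi => ?_, ?_⟩
    · rw [frA _ (by decide)]
      simp [hσ₄, run]
    -- An agent without a house has `f i₀ = 0`, so the augmented matching was written to row `0`,
    -- where `adopt` reads it.
    · rw [hadopt i hi, fr₄ _ (by decide), ← hrow i hi, hfi₀, zero_mul, zero_add]
    · rw [frA _ (by decide), fr₄ _ (by decide), hp₃]
      exact ⟨hs.isLowerSubsidy_raise hsel h0 hRS hcard, hs.augment hsel h0 hM hr hfi₀⟩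
  · left
    rw [run_ite_pos (by rw [hold]; omega), run, hold, Int.toNat_natCast, Expr.eval_one]
    refine ⟨?_, insert (f i₀) R, Function.update F (f i₀) (Function.update (F h₀) i₀ h₀),
      Finset.card_insert_of_notMem hsel.agent_notMem,
      ⟨fun i hi => ?_, hσ.house_le, fun k hk => ?_, fun h hh i hi => ?_⟩, ?_⟩
    rotate_right
    · rw [Mem.set_of_ne _ _ _ (by decide), hp₃]
      exact hs.extend hsel h0 hRS hcard hfi₀
    · rw [Mem.set_of_ne _ _ _ (by decide), fr₃ _ (by decide) (by decide) (by decide), hdone]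
    · rw [Mem.set_of_ne _ _ _ (by decide), fr₃ _ (by decide) (by decide) (by decide),
        hσ.house_eq i hi]
    · rw [Mem.set_same, fr₃ _ (by decide) (by decide) (by decide), Finset.mem_insert,
        ← hσ.reached_iff k hk]
      split
      · next h => simp [h]
      · next h => simp [h]
    · rw [Mem.set_of_ne _ _ _ (by decide)]
      by_cases h' : h = f i₀
      · rw [h', Function.update_self, hrow i hi]
      · rw [Function.update_of_ne h', hmove h i hi, if_neg h', fr₂ _ (by decide) (by decide)]
        exact hσ.hole_eq h (Finset.mem_of_mem_insert_of_ne hh h') i hi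

end SearchStep

/-! ### The best outcome for a fixed set of `n` houses -/

section OneSubset

/-- The house that the loop with counter `varRoot` considers. -/
def houseRoot : Expr := var varRoot + 1

/-- Only the root is reached. -/
def resetReached : Code :=
  seq (count varH 2 (store arrReached houseH 0))
    (seq (store arrReached 0 0) (store arrReached houseRoot 1))

/-- The matching in which the root is free is the current one. -/
def resetHole : Code :=
  count varI 1 (store arrHole (houseRoot * agents + var varI) (.load arrHouse (var varI)))

/-- Assign the root to an agent. -/
def assignRoot : Code :=
  seq (seq resetReached (seq (assign varDone 0) resetHole))
    (count varRound 1 (cond (1 - var varDone) searchStep))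

/-- Assign all available houses. -/
def assignAll : Code :=
  seq (seq (count varH 2 (store arrPrice houseH 0)) (count varI 1 (store arrHouse (var varI) 0)))
    (count varRoot 2 (cond (.load arrAvail houseRoot) assignRoot))

/-- The subsidy of agent `varI`. -/
def subsidyI : Expr := .load arrPrice (.load arrHouse (var varI))

/-- Compute the total subsidy. -/
def computeTotal : Code :=
  seq (assign varTotal 0) (count varI 1 (assign varTotal (var varTotal + subsidyI)))

/-- The position of the first entry of agent `varI` in the output. -/
def outPosition : Expr := var varI + var varI + var varI + 1

/-- Write the entries of agent `varI` of the output. -/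
def writeAgent : Code :=
  seq (store arrOut outPosition (.load arrHouse (var varI) - 1))
    (seq (store arrOut (outPosition + 1) subsidyI)
      (store arrOut (outPosition + 2) (var varDen)))

/-- Write the current outcome to the output. -/
def writeOutcome : Code :=
  seq (seq (assign varBest (var varTotal)) (assign varSolved 1))
    (seq (store arrOut 0 (agents + agents + agents)) (count varI 1 writeAgent))

/-- Find a best outcome for the available houses, and write it to the output if it is better than
the outcome there. -/
def solveAvailable : Code :=
  seq (seq assignAll computeTotal)
    (seq (cond (1 - var varSolved) writeOutcome)
      (cond (var varBest - var varTotal) writeOutcome))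

variable {n m : ℕ} {u : ℕ → ℕ → ℤ} {S M : Finset ℕ} {σ τ : Mem} {f : ℕ → ℕ}

/-- The case `k = 0` matters: cell `0` must be cleared so that agents without a house count as
unreached. -/
theorem run_resetReached (hinst : HoldsInstance n m u σ) {j : ℕ} (hj : σ varRoot 0 = j)
    {k : ℕ} (hk : k ≤ m) : 0 < resetReached.run σ arrReached k ↔ k = j + 1 := by
  have key := count_induction (σ := σ) (v := varH) (k := 2) (N := m)
    (P := store arrReached houseH 0) hinst.houses_eq
    (fun j τ => ∀ k, 1 ≤ k → k ≤ j → τ arrReached k = 0) (by omega) ?_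
  · have hroot : (count varH 2 (store arrReached houseH 0)).run σ varRoot = σ varRoot :=
      run_of_notMem_writes _ _ (by decide)
    rw [resetReached, run_seq, run_seq]
    generalize (count varH 2 (store arrReached houseH 0)).run σ = τ at key hroot
    have e : (j : ℤ) + 1 = ((j + 1 : ℕ) : ℤ) := by push_cast; rfl
    simp only [run, houseRoot, Expr.eval_add, eval_var, Expr.eval_one, Expr.eval_zero,
      Int.toNat_zero, Mem.set_same, Mem.set_of_ne _ _ _ (show varRoot ≠ arrReached by decide),
      hroot, hj, e, Int.toNat_natCast]
    by_cases h₁ : k = j + 1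
    · simp [h₁]
    · by_cases h₂ : k = 0
      · simp [h₂]
      · simp [h₁, h₂, key k (by omega) hk]
  · intro j τ hj hτ hfr h k h₁ h₂
    rw [Mem.set_of_ne _ _ _ (by decide), run, eval_houseH hτ, Int.toNat_natCast, Mem.set_same,
      Expr.eval_zero]
    split
    · rfl
    · exact h k h₁ (by omega)

theorem run_resetHole (hinst : HoldsInstance n m u σ) {j : ℕ} (hj : σ varRoot 0 = j) :
    ∀ i < n, resetHole.run σ arrHole ((j + 1) * n + i) = σ arrHouse i := by
  refine count_induction (σ := σ) (v := varI) (k := 1) (N := n)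
    (P := store arrHole (houseRoot * agents + var varI) (.load arrHouse (var varI)))
    hinst.agents_eq
    (fun t τ => ∀ i < t, τ arrHole ((j + 1) * n + i) = σ arrHouse i) (by simp) ?_
  intro t τ ht hτ hfr h i hi
  have e : ((houseRoot * agents + var varI).eval τ).toNat = (j + 1) * n + t := by
    have : (houseRoot * agents + var varI).eval τ = (((j + 1) * n + t : ℕ) : ℤ) := by
      simp [houseRoot, agents, hτ, hfr varRoot (by decide), hfr 0 (by decide), hj,
        hinst.agents_eq]
    rw [this, Int.toNat_natCast]
  rw [Mem.set_of_ne _ _ _ (by decide), run, e, Mem.set_same]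
  simp only [Nat.add_left_cancel_iff, Expr.eval_load, eval_var, hτ, Int.toNat_natCast,
    hfr arrHouse (by decide)]
  split
  · next h => rw [h]
  · exact h i (by omega)

/-- The memory holds an assignment of houses to agents with subsidies that are tight for the
houses in `M` and as low as possible. -/
def HoldsMatching (n : ℕ) (u : ℕ → ℕ → ℤ) (S M : Finset ℕ) (σ : Mem) : Prop :=
  ∃ f : ℕ → ℕ, (∀ i < n, σ arrHouse i = f i) ∧ IsLowerSubsidy n u S (σ arrPrice) ∧
    IsTightMatching n u S M (σ arrPrice) f

theorem HoldsMatching.congr (h : HoldsMatching n u S M σ) (h₁ : τ arrHouse = σ arrHouse)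
    (h₂ : τ arrPrice = σ arrPrice) : HoldsMatching n u S M τ := by
  simpa only [HoldsMatching, h₁, h₂] using h

/-- After `t` rounds the search has either augmented the matching or reached `t + 1` houses. Rounds
after the augmentation do nothing. -/
theorem HoldsMatching.run_assignRoot (h : HoldsMatching n u S M σ)
    (hinst : HoldsInstance n m u σ) (hS : HoldsAvailable m S σ)
    (hcard : S.card = n) (hM : M ⊆ S) {j : ℕ} (hj : σ varRoot 0 = j) (hr : j + 1 ∈ S)
    (hrM : j + 1 ∉ M) : HoldsMatching n u S (insert (j + 1) M) (assignRoot.run σ) := by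
  obtain ⟨f, hf, hlow, htight⟩ := h
  have h0 := hS.zero_notMem
  set P₀ := seq resetReached (seq (assign varDone 0) resetHole) with hP₀
  have fr₀ : ∀ a, a ∉ [6, 7, 8, 18, 19] → P₀.run σ a = σ a := fun a ha =>
    run_of_notMem_writes _ _ (by
      simp only [List.mem_cons, not_or] at ha
      simp [writes, P₀, resetReached, resetHole, ha])
  have hdone : P₀.run σ varDone 0 = 0 := by
    rw [hP₀, run_seq, run_seq, run_of_notMem_writes resetHole _ (by decide)]
    simp [run]
  have hsearch : HoldsSearch n m f {j + 1} (fun _ => f) (P₀.run σ) := by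
    refine ⟨fun i hi => ?_, fun i hi => ?_, fun k hk => ?_, fun h hh i hi => ?_⟩
    · rw [fr₀ _ (by decide), hf i hi]
    · by_cases hfi : f i = 0
      · omega
      · exact (Finset.mem_Icc.1 (hS.subset (hM (htight.mem i hi hfi)))).2
    · rw [hP₀, run_seq, run_seq, run_of_notMem_writes resetHole _ (by decide), run,
        Mem.set_of_ne _ _ _ (by decide), run_resetReached hinst hj hk, Finset.mem_singleton]
    · rw [Finset.mem_singleton] at hh
      rw [hP₀, run_seq, run_seq, hh]
      have fr : ∀ a, a ∉ [6, 8, 19] → (assign varDone 0).run (resetReached.run σ) a = σ a := by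
        intro a ha
        rw [← run_seq]
        refine run_of_notMem_writes _ _ ?_
        simp only [List.mem_cons, not_or] at ha
        simp [writes, resetReached, ha]
      rw [run_resetHole (hinst.congr (fr _ (by decide)) (fr _ (by decide)))
        (by rw [fr _ (by decide), hj]) i hi, fr _ (by decide), hf i hi]
  have key := count_induction (σ := P₀.run σ) (v := varRound) (k := 1) (N := n)
    (P := cond (1 - var varDone) searchStep) (by rw [fr₀ _ (by decide), hinst.agents_eq])
    (fun t τ => (τ varDone 0 = 0 ∧ ∃ R F, R.card = t + 1 ∧ HoldsSearch n m f R F τ ∧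
      IsSearchState n u S M (j + 1) (τ arrPrice) f R F) ∨
      (τ varDone 0 = 1 ∧ HoldsMatching n u S (insert (j + 1) M) τ)) ?_ ?_
  -- A search still open after `n` rounds would have reached `n + 1` houses of the `n`-element set
  -- `S`.
  · rcases key with ⟨-, R, F, hR, -, hs⟩ | ⟨-, h⟩
    · have := hs.card_reached_le hM hr hcard
      omega
    · exact h
  · have fr : ∀ a, a ≠ varRound → (P₀.run σ).set varRound 0 0 a = P₀.run σ a :=
      fun a h => Mem.set_of_ne _ _ _ h
    refine Or.inl ⟨by rw [fr _ (by decide), hdone], {j + 1}, fun _ => f, by simp,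
      ⟨?_, hsearch.house_le, ?_, ?_⟩, ?_⟩
    · rw [fr _ (by decide)]; exact hsearch.house_eq
    · rw [fr _ (by decide)]; exact hsearch.reached_iff
    · rw [fr _ (by decide)]; exact hsearch.hole_eq
    · rw [fr _ (by decide), fr₀ _ (by decide)]
      exact htight.isSearchState hlow h0 hr hrM
  · intro t τ ht hτ hfr h
    have fr : ∀ a, a ∉ varRound :: 6 :: 7 :: 8 :: 18 :: 19 :: searchStep.writes → τ a = σ a := by
      intro a ha
      simp only [List.mem_cons, not_or] at ha
      rw [hfr a (by simp [writes, ha]), fr₀ a (by simp [ha])]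
    have fr' : ∀ ρ : Mem, ∀ z a, a ≠ varRound → ρ.set varRound 0 z a = ρ a :=
      fun ρ z a h => Mem.set_of_ne _ _ _ h
    rcases h with ⟨hd, R, F, hR, hsearch, hs⟩ | ⟨hd, h⟩
    · rw [run_ite_pos (by simp [hd])]
      rcases run_searchStep (hinst.congr (fr _ (by decide)) (fr _ (by decide)))
        (hS.congr (fr _ (by decide))) hsearch hs hcard hM hr hrM hd with
        ⟨hd', R', F', hR', hsearch', hs'⟩ | ⟨hd', f', h₁, h₂, h₃⟩
      · refine Or.inl ⟨by rw [fr' _ _ _ (by decide), hd'], R', F', by omega,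
          ⟨?_, hsearch'.house_le, ?_, ?_⟩, ?_⟩
        · rw [fr' _ _ _ (by decide)]; exact hsearch'.house_eq
        · rw [fr' _ _ _ (by decide)]; exact hsearch'.reached_iff
        · rw [fr' _ _ _ (by decide)]; exact hsearch'.hole_eq
        · rwa [fr' _ _ _ (by decide)]
      · refine Or.inr ⟨by rw [fr' _ _ _ (by decide), hd'], ?_⟩
        exact HoldsMatching.congr ⟨f', h₁, h₂, h₃⟩ (fr' _ _ _ (by decide)) (fr' _ _ _ (by decide))
    · rw [run_ite_neg (by simp [hd]), run]
      exact Or.inr ⟨by rw [fr' _ _ _ (by decide), hd],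
        h.congr (fr' _ _ _ (by decide)) (fr' _ _ _ (by decide))⟩

/-- The houses of `S` are matched in increasing order. Zero prices and the empty matching start the
induction, since zero is below every nonnegative price. -/
theorem run_assignAll (hinst : HoldsInstance n m u σ) (hS : HoldsAvailable m S σ)
    (hcard : S.card = n) : HoldsMatching n u S S (assignAll.run σ) := by
  have hprice := count_induction (σ := σ) (v := varH) (k := 2) (N := m)
    (P := store arrPrice houseH 0) hinst.houses_eq
    (fun j τ => ∀ k, 1 ≤ k → k ≤ j → τ arrPrice k = 0) (by omega) (by
      intro j τ hj hτ hfr h k h₁ h₂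
      rw [Mem.set_of_ne _ _ _ (by decide), run, eval_houseH hτ, Int.toNat_natCast, Mem.set_same,
        Expr.eval_zero]
      split
      · rfl
      · exact h k h₁ (by omega))
  set σ₁ := (count varH 2 (store arrPrice houseH 0)).run σ with hσ₁
  have fr₁ : ∀ a, a ∉ [4, 19] → σ₁ a = σ a := fun a ha =>
    run_of_notMem_writes _ _ (by
      simp only [List.mem_cons, not_or] at ha
      simp [writes, ha])
  have hhouse := count_induction (σ := σ₁) (v := varI) (k := 1) (N := n)
    (P := store arrHouse (var varI) 0) (by rw [fr₁ _ (by decide), hinst.agents_eq])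
    (fun j τ => ∀ i < j, τ arrHouse i = 0) (by simp) (by
      intro j τ hj hτ hfr h i hi
      rw [Mem.set_of_ne _ _ _ (by decide), run, eval_var, hτ, Int.toNat_natCast, Mem.set_same,
        Expr.eval_zero]
      split
      · rfl
      · exact h i (by omega))
  set σ₂ := (count varI 1 (store arrHouse (var varI) 0)).run σ₁ with hσ₂
  have fr₂ : ∀ a, a ∉ [5, 18] → σ₂ a = σ₁ a := fun a ha =>
    run_of_notMem_writes _ _ (by
      simp only [List.mem_cons, not_or] at ha
      simp [writes, ha])
  have key := count_induction (σ := σ₂) (v := varRoot) (k := 2) (N := m)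
    (P := cond (.load arrAvail houseRoot) assignRoot)
    (by rw [fr₂ _ (by decide), fr₁ _ (by decide), hinst.houses_eq])
    (fun j τ => HoldsMatching n u S (S.filter (· ≤ j)) τ) ?_ ?_
  · rw [Finset.filter_true_of_mem fun k hk => (Finset.mem_Icc.1 (hS.subset hk)).2] at key
    exact key
  · have hempty : S.filter (· ≤ 0) = ∅ := Finset.filter_false_of_mem fun k hk => by
      have := Finset.mem_Icc.1 (hS.subset hk)
      omega
    rw [hempty]
    refine ⟨fun _ => 0, ?_, ?_, isTightMatching_empty⟩
    · rw [Mem.set_of_ne _ _ _ (by decide)]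
      exact hhouse
    · rw [Mem.set_of_ne _ _ _ (by decide), fr₂ _ (by decide)]
      refine isLowerSubsidy_of_eq_zero fun k hk => ?_
      have := Finset.mem_Icc.1 (hS.subset hk)
      exact hprice k this.1 this.2
  · intro j τ hj hτ hfr h
    have fr : ∀ a, a ∉ 4 :: 5 :: 18 :: 19 :: 20 :: assignRoot.writes → τ a = σ a := by
      intro a ha
      simp only [List.mem_cons, not_or] at ha
      rw [hfr a (by simp [writes, ha]), fr₂ a (by simp [ha]), fr₁ a (by simp [ha])]
    have e : (Expr.load arrAvail houseRoot).eval τ = σ arrAvail (j + 1) := by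
      have : (houseRoot.eval τ).toNat = j + 1 := by simp [houseRoot, hτ]
      rw [Expr.eval_load, this, fr _ (by decide)]
    have hle : ∀ k, k ≤ j + 1 ↔ k = j + 1 ∨ k ≤ j := by omega
    by_cases hjS : j + 1 ∈ S
    · rw [run_ite_pos (by rwa [e, hS.iff_succ hj])]
      have hins : S.filter (· ≤ j + 1) = insert (j + 1) (S.filter (· ≤ j)) := by
        ext k
        simp only [Finset.mem_filter, Finset.mem_insert, hle]
        constructor
        · tauto
        · rintro (rfl | h) <;> tauto
      rw [hins]
      refine (h.run_assignRoot (hinst.congr (fr _ (by decide)) (fr _ (by decide)))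
        (hS.congr (fr _ (by decide))) hcard (Finset.filter_subset _ _) hτ hjS (by simp)).congr
        (Mem.set_of_ne _ _ _ (by decide)) (Mem.set_of_ne _ _ _ (by decide))
    · rw [run_ite_neg (by rwa [e, hS.iff_succ hj]), run]
      have hins : S.filter (· ≤ j + 1) = S.filter (· ≤ j) := by
        refine Finset.filter_congr fun k hk => ?_
        have : k ≠ j + 1 := by rintro rfl; exact hjS hk
        rw [hle]
        tauto
      rw [hins]
      exact h.congr (Mem.set_of_ne _ _ _ (by decide)) (Mem.set_of_ne _ _ _ (by decide))

theorem run_computeTotal (hinst : HoldsInstance n m u σ) (hf : ∀ i < n, σ arrHouse i = f i) :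
    computeTotal.run σ varTotal 0 = ∑ i ∈ Finset.range n, σ arrPrice (f i) := by
  refine count_induction (σ := σ.set varTotal 0 0) (v := varI) (k := 1) (N := n)
    (P := assign varTotal (var varTotal + subsidyI)) (by simp [hinst.agents_eq])
    (fun j τ => τ varTotal 0 = ∑ i ∈ Finset.range j, σ arrPrice (f i)) (by simp) ?_
  intro j τ hj hτ hfr h
  have e : subsidyI.eval τ = σ arrPrice (f j) := by
    simp [subsidyI, hτ, hfr arrHouse (by decide), hfr arrPrice (by decide), hf j hj]
  rw [Mem.set_of_ne _ _ _ (by decide), run, Expr.eval_add, e, eval_var, h, Finset.sum_range_succ]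
  simp

/-- The output array holds an envy-free outcome, with subsidies given as fractions with common
denominator, and its total is in `varBest`. -/
def HoldsOutcome (n m : ℕ) (u : ℕ → ℕ → ℤ) (σ : Mem) : Prop :=
  ∃ (a : ℕ → ℕ) (s : ℕ → ℤ), σ arrOut 0 = 3 * n ∧
    (∀ i < n, σ arrOut (3 * i + 1) = a i ∧ σ arrOut (3 * i + 2) = s i ∧
      σ arrOut (3 * i + 3) = σ varDen 0) ∧
    (∀ i < n, a i < m ∧ 0 ≤ s i) ∧ (∀ i < n, ∀ j < n, a i = a j → i = j) ∧
    (∀ i < n, ∀ j < n, u i (a j + 1) + s j ≤ u i (a i + 1) + s i) ∧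
    σ varBest 0 = ∑ i ∈ Finset.range n, s i

theorem HoldsOutcome.congr (h : HoldsOutcome n m u σ) (h₁ : τ arrOut = σ arrOut)
    (h₂ : τ varDen = σ varDen) (h₃ : τ varBest = σ varBest) : HoldsOutcome n m u τ := by
  simpa only [HoldsOutcome, h₁, h₂, h₃] using h

/-- All assigned houses lie in `S`, so tightness on `S` gives envy-freeness. House numbers drop by
one because the output counts houses from `0`. -/
theorem run_writeOutcome (hinst : HoldsInstance n m u σ) (hS : HoldsAvailable m S σ)
    (hf : ∀ i < n, σ arrHouse i = f i) (hp : ∀ k ∈ S, 0 ≤ σ arrPrice k)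
    (hfS : ∀ i < n, f i ∈ S) (hinj : ∀ i < n, ∀ j < n, f i = f j → i = j)
    (htight : ∀ i < n, ∀ h ∈ S, u i h + σ arrPrice h ≤ u i (f i) + σ arrPrice (f i))
    (htotal : σ varTotal 0 = ∑ i ∈ Finset.range n, σ arrPrice (f i)) :
    HoldsOutcome n m u (writeOutcome.run σ) ∧ writeOutcome.run σ varSolved 0 = 1 ∧
      writeOutcome.run σ varBest 0 = σ varTotal 0 := by
  have hfm : ∀ i < n, 1 ≤ f i ∧ f i ≤ m := fun i hi =>
    Finset.mem_Icc.1 (hS.subset (hfS i hi))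
  set P₀ := seq (seq (assign varBest (var varTotal)) (assign varSolved 1))
    (store arrOut 0 (agents + agents + agents)) with hP₀
  set σ₁ := P₀.run σ with hσ₁
  have fr₁ : ∀ a, a ∉ [1, 16, 17] → σ₁ a = σ a := fun a ha =>
    run_of_notMem_writes _ _ (by
      simp only [List.mem_cons, not_or] at ha
      simp [writes, hP₀, ha])
  have hrun : writeOutcome.run σ = (count varI 1 writeAgent).run σ₁ := rfl
  have fr₂ : ∀ a, a ∉ [1, 18] → writeOutcome.run σ a = σ₁ a := fun a ha => by
    rw [hrun]
    refine run_of_notMem_writes _ _ ?_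
    simp only [List.mem_cons, not_or] at ha
    simp [writes, writeAgent, ha]
  have hbest : writeOutcome.run σ varBest 0 = σ varTotal 0 := by
    rw [fr₂ _ (by decide)]
    simp [hσ₁, hP₀, run]
  have key := count_induction (σ := σ₁) (v := varI) (k := 1) (N := n)
    (P := writeAgent) (by rw [fr₁ _ (by decide), hinst.agents_eq])
    (fun j τ => τ arrOut 0 = 3 * n ∧ ∀ i < j, τ arrOut (3 * i + 1) = ((f i - 1 : ℕ) : ℤ) ∧
      τ arrOut (3 * i + 2) = σ arrPrice (f i) ∧ τ arrOut (3 * i + 3) = σ varDen 0) ?_ ?_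
  · rw [← hrun] at key
    refine ⟨⟨fun i => f i - 1, fun i => σ arrPrice (f i), key.1, fun i hi => ?_, fun i hi => ?_,
      fun i hi j hj hij => ?_, fun i hi j hj => ?_, ?_⟩, ?_, hbest⟩
    · rw [fr₂ varDen (by decide), fr₁ varDen (by decide)]
      exact key.2 i hi
    · have := hfm i hi
      exact ⟨show f i - 1 < m by omega, hp _ (hfS i hi)⟩
    · change f i - 1 = f j - 1 at hij
      have := hfm i hi
      have := hfm j hj
      exact hinj i hi j hj (by omega)
    · rw [Nat.sub_add_cancel (hfm i hi).1, Nat.sub_add_cancel (hfm j hj).1]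
      exact htight i hi _ (hfS j hj)
    · rw [hbest, htotal]
    · rw [fr₂ _ (by decide)]
      simp [hσ₁, hP₀, run]
  · refine ⟨?_, by simp⟩
    simp [hσ₁, hP₀, run, agents, hinst.agents_eq]
    ring
  · rintro j τ hj hτ hfr ⟨h₁, h₂⟩
    have fr : ∀ a, a ∉ [1, 16, 17, 18] → τ a = σ a := fun a ha => by
      simp only [List.mem_cons, not_or] at ha
      rw [hfr a (by simp [writes, writeAgent, ha]), fr₁ a (by simp [ha])]
    have hpos : ∀ ρ : Mem, ρ varI 0 = j → outPosition.eval ρ = ((3 * j + 1 : ℕ) : ℤ) := by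
      intro ρ hρ
      simp [outPosition, hρ]
      ring
    have hrunA : (writeAgent.run τ).set varI 0 ((j + 1 : ℕ) : ℤ) arrOut =
        (((τ.set arrOut (3 * j + 1) ((f j - 1 : ℕ) : ℤ)).set arrOut (3 * j + 2)
          (σ arrPrice (f j))).set arrOut (3 * j + 3) (σ varDen 0)) arrOut := by
      have hpos' : ∀ ρ : Mem, ρ varI 0 = j → (outPosition.eval ρ).toNat = 3 * j + 1 ∧
          ((outPosition + 1).eval ρ).toNat = 3 * j + 2 ∧
          ((outPosition + 2).eval ρ).toNat = 3 * j + 3 := by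
        intro ρ hρ
        rw [Expr.eval_add, Expr.eval_add, hpos ρ hρ, Expr.eval_one, Expr.eval_ofNat]
        refine ⟨Int.toNat_natCast _, ?_, ?_⟩ <;> omega
      have hcast : (f j : ℤ) - 1 = ((f j - 1 : ℕ) : ℤ) := by
        have := hfm j hj
        omega
      rw [Mem.set_of_ne _ _ _ (by decide)]
      simp only [writeAgent, run]
      rw [(hpos' _ hτ).1, (hpos' _ (by rw [Mem.set_of_ne _ _ _ (by decide), hτ])).2.1,
        (hpos' _ (by rw [Mem.set_of_ne _ _ _ (by decide), Mem.set_of_ne _ _ _ (by decide),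
          hτ])).2.2]
      simp [subsidyI, hτ, fr arrHouse (by decide), fr arrPrice (by decide), fr varDen (by decide),
        hf j hj, hcast]
    rw [hrunA]
    refine ⟨by simpa using h₁, fun i hi => ?_⟩
    simp only [Mem.set_same]
    by_cases hij : i = j
    · subst hij
      simp
    · obtain ⟨h₃, h₄, h₅⟩ := h₂ i (by omega)
      refine ⟨?_, ?_, ?_⟩
      · rwa [if_neg (by omega), if_neg (by omega), if_neg (by omega)]
      · rwa [if_neg (by omega), if_neg (by omega), if_neg (by omega)]
      · rwa [if_neg (by omega), if_neg (by omega), if_neg (by omega)]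

/-- If an outcome has been found, then the output array holds one. -/
def IsSound (n m : ℕ) (u : ℕ → ℕ → ℤ) (σ : Mem) : Prop :=
  σ varSolved 0 = 0 ∨ σ varSolved 0 = 1 ∧ HoldsOutcome n m u σ

/-- An outcome has been found that is at least as good as any outcome on the houses in `S`. -/
def Dominates (n : ℕ) (u : ℕ → ℕ → ℤ) (S : Finset ℕ) (σ : Mem) : Prop :=
  σ varSolved 0 = 1 ∧ ∀ a p, IsSupported n u S a p →
    (σ varBest 0 : ℝ) ≤ ∑ i ∈ Finset.range n, p (a i)

theorem IsSound.congr (h : IsSound n m u σ) (h₁ : τ arrOut = σ arrOut)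
    (h₂ : τ varDen = σ varDen) (h₃ : τ varBest = σ varBest) (h₄ : τ varSolved = σ varSolved) :
    IsSound n m u τ := by
  simpa only [IsSound, HoldsOutcome, h₁, h₂, h₃, h₄] using h

theorem Dominates.mono (h : Dominates n u S σ) (h₃ : τ varBest 0 ≤ σ varBest 0)
    (h₄ : τ varSolved 0 = 1) : Dominates n u S τ :=
  ⟨h₄, fun a p hap => le_trans (by exact_mod_cast h₃) (h.2 a p hap)⟩

theorem Dominates.congr (h : Dominates n u S σ) (h₃ : τ varBest = σ varBest)
    (h₄ : τ varSolved = σ varSolved) : Dominates n u S τ :=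
  h.mono (by rw [h₃]) (by rw [h₄, h.1])

/-- The first outcome is always written, a later one only if its total is strictly smaller. So
`varBest` never increases once set, and domination of earlier sets persists. -/
theorem run_solveAvailable (hinst : HoldsInstance n m u σ) (hS : HoldsAvailable m S σ)
    (hcard : S.card = n) (hsound : IsSound n m u σ) :
    IsSound n m u (solveAvailable.run σ) ∧ Dominates n u S (solveAvailable.run σ) ∧
      ∀ S', Dominates n u S' σ → Dominates n u S' (solveAvailable.run σ) := by
  obtain ⟨f, hf, hlow, htight⟩ := run_assignAll hinst hS hcard
  have h0 := hS.zero_notMem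
  have hne := htight.ne_zero hcard.ge h0
  have frA : ∀ a, a ∉ assignAll.writes → assignAll.run σ a = σ a :=
    fun a ha => run_of_notMem_writes _ _ ha
  have frT : ∀ a, a ∉ [15, 18] → computeTotal.run (assignAll.run σ) a = assignAll.run σ a :=
    fun a ha => run_of_notMem_writes _ _ (by
      simp only [List.mem_cons, not_or] at ha
      simp [writes, computeTotal, ha])
  have htotal := run_computeTotal (f := f)
    (hinst.congr (τ := assignAll.run σ) (frA _ (by decide)) (frA _ (by decide))) hf
  set σ₁ := computeTotal.run (assignAll.run σ) with hσ₁
  have fr₁ : ∀ a, a ∉ assignAll.writes → a ∉ [15, 18] → σ₁ a = σ a :=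
    fun a h₁ h₂ => (frT a h₂).trans (frA a h₁)
  have hwrite := run_writeOutcome (σ := σ₁) (S := S) (f := f)
    (hinst.congr (fr₁ _ (by decide) (by decide)) (fr₁ _ (by decide) (by decide)))
    (hS.congr (fr₁ _ (by decide) (by decide))) (by rwa [frT _ (by decide)])
    (by rw [frT _ (by decide)]; exact hlow.nonneg) (fun i hi => htight.mem i hi (hne i hi))
    (fun i hi j hj => htight.inj i hi j hj (hne i hi))
    (by rw [frT _ (by decide)]; exact fun i hi => htight.tight i hi (hne i hi))
    (by rw [htotal, frT arrPrice (by decide)])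
  have hdom : ∀ τ : Mem, τ varSolved 0 = 1 → τ varBest 0 ≤ σ₁ varTotal 0 →
      Dominates n u S τ := by
    intro τ h₁ h₂
    refine ⟨h₁, fun a p hap => ?_⟩
    refine le_trans ?_ (hlow.sum_le htight h0 hcard hap)
    rw [← htotal]
    exact_mod_cast h₂
  have hrun : solveAvailable.run σ = (cond (var varBest - var varTotal) writeOutcome).run
    ((Code.cond (1 - var varSolved) writeOutcome).run σ₁) := rfl
  have frO : ∀ ρ : Mem, writeOutcome.run ρ varTotal = ρ varTotal := fun ρ =>
    run_of_notMem_writes _ _ (by decide)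
  have hsolved : σ₁ varSolved = σ varSolved := fr₁ _ (by decide) (by decide)
  have hbest : σ₁ varBest = σ varBest := fr₁ _ (by decide) (by decide)
  rcases hsound with hsol | ⟨hsol, hout⟩
  · have h₁ : (Code.cond (1 - var varSolved) writeOutcome).run σ₁ = writeOutcome.run σ₁ :=
      run_ite_pos (by simp [hsolved, hsol]) _ _
    rw [hrun, h₁, run_ite_neg (by simp [frO, hwrite.2.2]), run]
    refine ⟨Or.inr ⟨hwrite.2.1, hwrite.1⟩, hdom _ hwrite.2.1 hwrite.2.2.le, fun S' h => ?_⟩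
    have := h.1
    omega
  · have h₁ : (Code.cond (1 - var varSolved) writeOutcome).run σ₁ = σ₁ :=
      run_ite_neg (by simp [hsolved, hsol]) _ _
    rw [hrun, h₁]
    by_cases hlt : 0 < (var varBest - var varTotal).eval σ₁
    · rw [run_ite_pos hlt]
      rw [Expr.eval_sub, eval_var, eval_var, hbest] at hlt
      refine ⟨Or.inr ⟨hwrite.2.1, hwrite.1⟩, hdom _ hwrite.2.1 hwrite.2.2.le, fun S' h => ?_⟩
      exact h.mono (by rw [hwrite.2.2]; omega) hwrite.2.1
    · rw [run_ite_neg hlt, run]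
      rw [Expr.eval_sub, eval_var, eval_var] at hlt
      have hsol₁ : σ₁ varSolved 0 = 1 := by rw [hsolved, hsol]
      refine ⟨Or.inr ⟨hsol₁, hout.congr (fr₁ _ (by decide) (by decide))
        (fr₁ _ (by decide) (by decide)) hbest⟩, hdom _ hsol₁ (by omega), fun S' h => ?_⟩
      exact h.congr hbest hsolved

end OneSubset

/-! ### Enumeration of the sets of houses and scaling of utilities -/

section Enumeration

/-- Run `P` with `c` of the available houses made unavailable, in all possible ways. -/
def enumerate (P : Code) : ℕ → Code
  | 0 => P
  | c + 1 => count (22 + c) 2 (cond (.load arrAvail (var (22 + c) + 1))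
      (seq (store arrAvail (var (22 + c) + 1) 0)
        (seq (enumerate P c) (store arrAvail (var (22 + c) + 1) 1))))

/-- Compute a common denominator. -/
def computeDen : Code :=
  seq (assign varDen 1) (count varI 1 (count varH 2 (assign varDen
    (var varDen * .load 0 (position (var varI) houseH + position (var varI) houseH + 2)))))

/-- Make all houses available. -/
def initAvail : Code := count varH 2 (store arrAvail houseH 1)

/-- The algorithm for `c` more houses than agents. -/
def minimumSubsidyCode (c : ℕ) : Code :=
  seq (seq computeDen initAvail) (enumerate solveAvailable c)

/-- Each nesting level has its own counter, numbered from `22` and hence distinct from all other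
variables. So inner levels leave the counters of the outer loops alone. -/
theorem mem_writes_enumerate {P : Code} {c a : ℕ} (h : a ∈ (enumerate P c).writes) :
    a ∈ P.writes ∨ a = arrAvail ∨ 22 ≤ a ∧ a < 22 + c := by
  induction c with
  | zero => exact Or.inl h
  | succ c ih =>
    simp only [enumerate, writes, List.mem_cons, List.mem_append, List.not_mem_nil, or_false] at h
    rcases h with rfl | rfl | h | rfl
    · omega
    · simp
    · rcases ih h with h | h | h
      · exact Or.inl h
      · simp [h]
      · omega
    · simp

theorem solveAvailable_writes_lt {a : ℕ} (h : a ∈ solveAvailable.writes) :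
    a < 22 ∧ a ≠ 0 ∧ a ≠ varDen ∧ a ≠ arrAvail := by
  have : ∀ a ∈ solveAvailable.writes, a < 22 ∧ a ≠ 0 ∧ a ≠ varDen ∧ a ≠ arrAvail := by decide
  exact this a h

theorem isTame_enumerate (c : ℕ) : (enumerate solveAvailable c).isTame := by
  induction c with
  | zero => decide
  | succ c ih =>
    have h : 22 + c ∉ (enumerate solveAvailable c).writes := fun h => by
      rcases mem_writes_enumerate h with h | h | h
      · have := (solveAvailable_writes_lt h).1
        omega
      · omega
      · omega
    have h₁ : (Expr.load arrAvail (var (22 + c) + 1)).isTame = true := rfl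
    have h₂ : (var (22 + c) + 1).isTame = true := rfl
    have h₃ : (0 : Expr).isTame = true := rfl
    have h₄ : (1 : Expr).isTame = true := rfl
    simp [enumerate, isTame, writes, h, ih, h₁, h₂, h₃, h₄]
    omega

theorem isTame_minimumSubsidyCode (c : ℕ) : (minimumSubsidyCode c).isTame := by
  have h : (seq computeDen initAvail).isTame = true := by decide
  simp [minimumSubsidyCode, isTame, isTame_enumerate] at h ⊢
  exact h

variable {n m : ℕ} {u : ℕ → ℕ → ℤ} {S : Finset ℕ} {σ τ : Mem}

/-- An `n`-element `S' ⊆ S` smaller than `S` omits some house of `S`. In the round that removes this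
house, the inner enumeration handles `S'`. The house is made available again afterwards, so the next
round starts from the same `S`. -/
theorem run_enumerate (c : ℕ) (hinst : HoldsInstance n m u σ) (hS : HoldsAvailable m S σ)
    (hcard : S.card = n + c) (hsound : IsSound n m u σ) :
    HoldsAvailable m S ((enumerate solveAvailable c).run σ) ∧
      IsSound n m u ((enumerate solveAvailable c).run σ) ∧
      (∀ S' ⊆ S, S'.card = n → Dominates n u S' ((enumerate solveAvailable c).run σ)) ∧
      ∀ S', Dominates n u S' σ → Dominates n u S' ((enumerate solveAvailable c).run σ) := by
  induction c generalizing S σ with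
  | zero =>
    obtain ⟨h₁, h₂, h₃⟩ := run_solveAvailable hinst hS hcard hsound
    refine ⟨hS.congr (run_of_notMem_writes _ _ (by decide)), h₁, fun S' hS' hc => ?_, h₃⟩
    rw [Finset.eq_of_subset_of_card_le hS' (by omega)]
    exact h₂
  | succ c ih =>
    have hw : ∀ a, a = 0 ∨ a = varDen →
        a ∉ (enumerate solveAvailable (c + 1)).writes := fun a ha h => by
      rcases mem_writes_enumerate h with h | h | h
      · have := solveAvailable_writes_lt h
        omega
      · omega
      · omega
    have hv : 22 + c ∉ (enumerate solveAvailable c).writes := fun h => by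
      rcases mem_writes_enumerate h with h | h | h
      · have := (solveAvailable_writes_lt h).1
        omega
      · omega
      · omega
    have frv : ∀ (ρ : Mem) z a, a < 22 → ρ.set (22 + c) 0 z a = ρ a := fun ρ z a h =>
      Mem.set_of_ne _ _ _ (by omega)
    -- After `j` rounds exactly those `S'` that omit some house of `S` with number at most `j` are
    -- claimed to be dominated.
    have key := count_induction (σ := σ) (v := 22 + c) (k := 2) (N := m)
      (P := cond (.load arrAvail (var (22 + c) + 1))
        (seq (store arrAvail (var (22 + c) + 1) 0)
          (seq (enumerate solveAvailable c) (store arrAvail (var (22 + c) + 1) 1))))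
      hinst.houses_eq
      (fun j τ => HoldsAvailable m S τ ∧ IsSound n m u τ ∧
        (∀ S' ⊆ S, S'.card = n → (∃ k ∈ S, k ≤ j ∧ k ∉ S') → Dominates n u S' τ) ∧
        ∀ S', Dominates n u S' σ → Dominates n u S' τ) ?_ ?_
    · refine ⟨key.1, key.2.1, fun S' hS' hc => key.2.2.1 S' hS' hc ?_, key.2.2.2⟩
      obtain ⟨k, hk, hk'⟩ := Finset.exists_of_ssubset (Finset.ssubset_iff_subset_ne.2 ⟨hS', by
        rintro rfl; omega⟩)
      exact ⟨k, hk, (Finset.mem_Icc.1 (hS.subset hk)).2, hk'⟩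
    · refine ⟨hS.congr (frv _ _ _ (by decide)), hsound.congr (frv _ _ _ (by decide))
        (frv _ _ _ (by decide)) (frv _ _ _ (by decide)) (frv _ _ _ (by decide)),
        fun S' _ _ ⟨k, hk, hk0, _⟩ => ?_, fun S' h => h.congr (frv _ _ _ (by decide))
          (frv _ _ _ (by decide))⟩
      have := Finset.mem_Icc.1 (hS.subset hk)
      omega
    · rintro j τ hj hτ hfr ⟨h₁, h₂, h₃, h₄⟩
      have hinstτ : HoldsInstance n m u τ := hinst.congr (hfr 0 (hw _ (by simp)))
        (hfr varDen (hw _ (by simp)))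
      have hpos : ∀ ρ : Mem, ρ (22 + c) 0 = j →
          ((var (22 + c) + 1).eval ρ).toNat = j + 1 := by
        intro ρ hρ
        simp [hρ]
      have e : (Expr.load arrAvail (var (22 + c) + 1)).eval τ = τ arrAvail (j + 1) := by
        rw [Expr.eval_load, hpos τ hτ]
      by_cases hjS : j + 1 ∈ S
      · rw [run_ite_pos (by rwa [e, h₁.iff_succ hj]), run_seq, run_seq]
        set τ₁ := (store arrAvail (var (22 + c) + 1) 0).run τ with hτ₁
        have hτ₁' : τ₁ = τ.set arrAvail (j + 1) 0 := by rw [hτ₁, run, hpos τ hτ, Expr.eval_zero]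
        have fr₁ : ∀ a, a ≠ arrAvail → τ₁ a = τ a := fun a ha => by
          rw [hτ₁', Mem.set_of_ne _ _ _ ha]
        have hS₁ : HoldsAvailable m (S.erase (j + 1)) τ₁ := by
          refine ⟨(Finset.erase_subset _ _).trans h₁.subset, fun k hk => ?_⟩
          rw [hτ₁', Mem.set_same, Finset.mem_erase, ← h₁.iff k hk]
          split
          · next h => simp [h]
          · next h => simp [h]
        have hcard₁ : (S.erase (j + 1)).card = n + c := by
          rw [Finset.card_erase_of_mem hjS]
          omega
        obtain ⟨g₁, g₂, g₃, g₄⟩ := ih (hinstτ.congr (fr₁ _ (by decide)) (fr₁ _ (by decide))) hS₁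
          hcard₁ (h₂.congr (fr₁ _ (by decide)) (fr₁ _ (by decide)) (fr₁ _ (by decide))
            (fr₁ _ (by decide)))
        set τ₂ := (enumerate solveAvailable c).run τ₁ with hτ₂
        have hτ₂v : τ₂ (22 + c) 0 = j := by
          rw [hτ₂, run_of_notMem_writes _ _ hv, fr₁ _ (by omega), hτ]
        rw [run, hpos τ₂ hτ₂v, Expr.eval_one]
        have fr₂ : ∀ z a, a < 22 → a ≠ arrAvail →
            (τ₂.set arrAvail (j + 1) 1).set (22 + c) 0 z a = τ₂ a := fun z a h h' => by
          rw [frv _ _ _ h, Mem.set_of_ne _ _ _ h']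
        have hdom : ∀ S' z, Dominates n u S' τ₂ →
            Dominates n u S' ((τ₂.set arrAvail (j + 1) 1).set (22 + c) 0 z) := fun S' z h =>
          h.congr (fr₂ _ _ (by decide) (by decide)) (fr₂ _ _ (by decide) (by decide))
        have hmono : ∀ S', Dominates n u S' τ → Dominates n u S' τ₂ := fun S' h =>
          g₄ S' (h.congr (fr₁ _ (by decide)) (fr₁ _ (by decide)))
        refine ⟨⟨h₁.subset, fun k hk => ?_⟩, g₂.congr (fr₂ _ _ (by decide) (by decide))
          (fr₂ _ _ (by decide) (by decide)) (fr₂ _ _ (by decide) (by decide))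
          (fr₂ _ _ (by decide) (by decide)), fun S' hS' hc ⟨k, hk, hkj, hkS'⟩ => hdom _ _ ?_,
          fun S' h => hdom _ _ (hmono _ (h₄ S' h))⟩
        · rw [frv _ _ _ (by decide), Mem.set_same]
          split
          · next h => simp [h, hjS]
          · next h => rw [g₁.iff k hk, Finset.mem_erase, and_iff_right h]
        -- If `S'` contains `j + 1`, the house it omits came earlier and the old domination
        -- persists; otherwise `S'` lies in the reduced set and the inner enumeration covers it.
        · by_cases hjS' : j + 1 ∈ S'
          · refine hmono _ (h₃ S' hS' hc ⟨k, hk, ?_, hkS'⟩)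
            have : k ≠ j + 1 := by rintro rfl; exact hkS' hjS'
            omega
          · exact g₃ S' (Finset.subset_erase.2 ⟨hS', hjS'⟩) hc
      · rw [run_ite_neg (by rwa [e, h₁.iff_succ hj]), run]
        refine ⟨h₁.congr (frv _ _ _ (by decide)), h₂.congr (frv _ _ _ (by decide))
          (frv _ _ _ (by decide)) (frv _ _ _ (by decide)) (frv _ _ _ (by decide)),
          fun S' hS' hc ⟨k, hk, hkj, hkS'⟩ => ?_, fun S' h => (h₄ S' h).congr
          (frv _ _ _ (by decide)) (frv _ _ _ (by decide))⟩
        refine (h₃ S' hS' hc ⟨k, hk, ?_, hkS'⟩).congr (frv _ _ _ (by decide))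
          (frv _ _ _ (by decide))
        have : k ≠ j + 1 := by rintro rfl; exact hjS hk
        omega

theorem run_initAvail (hm : σ 0 2 = m) :
    HoldsAvailable m (Finset.Icc 1 m) (initAvail.run σ) := by
  have key := count_induction (σ := σ) (v := varH) (k := 2) (N := m)
    (P := store arrAvail houseH 1) hm
    (fun j τ => ∀ k, 1 ≤ k → k ≤ j → τ arrAvail k = 1) (by omega) (by
      intro j τ hj hτ hfr h k h₁ h₂
      rw [Mem.set_of_ne _ _ _ (by decide), run, eval_houseH hτ, Int.toNat_natCast, Mem.set_same,
        Expr.eval_one]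
      split
      · rfl
      · exact h k h₁ (by omega))
  refine ⟨subset_rfl, fun k hk => ?_⟩
  obtain ⟨h₁, h₂⟩ := Finset.mem_Icc.1 hk
  have : initAvail.run σ arrAvail k = 1 := key k h₁ h₂
  simp [this, h₁, h₂]

/-- The common denominator is the product of all denominators, built by multiplying with one input
cell at a time, as tameness demands. -/
theorem run_computeDen (hn : σ 0 1 = n) (hm : σ 0 2 = m)
    (hden : ∀ i < n, ∀ k < m, 0 < σ 0 (2 * (i * m + (k + 1)) + 2)) :
    0 < computeDen.run σ varDen 0 ∧
      ∀ i < n, ∀ k < m, σ 0 (2 * (i * m + (k + 1)) + 2) ∣ computeDen.run σ varDen 0 := by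
  set P := assign varDen
    (var varDen * .load 0 (position (var varI) houseH + position (var varI) houseH + 2)) with hP
  refine count_induction (σ := σ.set varDen 0 1) (v := varI) (k := 1) (N := n)
    (P := count varH 2 P) (by simp [hn])
    (fun j τ => 0 < τ varDen 0 ∧
      ∀ i < j, ∀ k < m, σ 0 (2 * (i * m + (k + 1)) + 2) ∣ τ varDen 0) (by simp) ?_
  rintro j τ hj hτ hfr ⟨h₁, h₂⟩
  have hτ0 : τ 0 = σ 0 := hfr 0 (by simp [writes, hP])
  rw [Mem.set_of_ne _ _ _ (by decide)]
  have key := count_induction (σ := τ) (v := varH) (k := 2) (N := m) (P := P)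
    (by rw [hτ0, hm])
    (fun l ρ => 0 < ρ varDen 0 ∧ τ varDen 0 ∣ ρ varDen 0 ∧
      ∀ k < l, σ 0 (2 * (j * m + (k + 1)) + 2) ∣ ρ varDen 0) (by simpa using h₁) ?_
  · refine ⟨key.1, fun i hi k hk => ?_⟩
    by_cases hij : i = j
    · exact hij ▸ key.2.2 k hk
    · exact (h₂ i (by omega) k hk).trans key.2.1
  · rintro l ρ hl hρ hfr' ⟨g₁, g₂, g₃⟩
    have hρ0 : ρ 0 = σ 0 := (hfr' 0 (by simp [writes, hP])).trans hτ0
    have hρI : ρ varI 0 = j := by rw [hfr' varI (by simp [writes, hP]), hτ]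
    have hpos : ((position (var varI) houseH + position (var varI) houseH + 2).eval ρ).toNat =
        2 * (j * m + (l + 1)) + 2 := by
      have : (position (var varI) houseH + position (var varI) houseH + 2).eval ρ =
          ((2 * (j * m + (l + 1)) + 2 : ℕ) : ℤ) := by
        simp [position, houseH, hρI, hρ, hρ0, hm]
        ring
      rw [this, Int.toNat_natCast]
    have hrun : P.run ρ varDen 0 = ρ varDen 0 * σ 0 (2 * (j * m + (l + 1)) + 2) := by
      rw [hP, run, Expr.eval_mul, Expr.eval_load, hpos, hρ0, eval_var]
      simp
    rw [Mem.set_of_ne _ _ _ (by decide), hrun]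
    refine ⟨mul_pos g₁ (hden j hj l hl), g₂.mul_right _, fun k hk => ?_⟩
    by_cases hkl : k = l
    · exact hkl ▸ dvd_mul_left _ _
    · exact (g₃ k (by omega)).mul_right _

/-- What the algorithm computes: an envy-free outcome that is at least as good as any other
outcome, for utilities that are multiplied by a common denominator. -/
theorem run_minimumSubsidyCode {c : ℕ} (hn : σ 0 1 = n) (hm : σ 0 2 = ((n + c : ℕ) : ℤ))
    (hsolved : σ varSolved 0 = 0)
    (hnum : ∀ i < n, ∀ k < n + c, 0 ≤ σ 0 (2 * (i * (n + c) + (k + 1)) + 1))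
    (hden : ∀ i < n, ∀ k < n + c, 0 < σ 0 (2 * (i * (n + c) + (k + 1)) + 2)) :
    ∃ (D : ℤ) (u : ℕ → ℕ → ℤ), 0 < D ∧
      (∀ i < n, ∀ k < n + c, u i (k + 1) * σ 0 (2 * (i * (n + c) + (k + 1)) + 2) =
        D * σ 0 (2 * (i * (n + c) + (k + 1)) + 1)) ∧
      (minimumSubsidyCode c).run σ varDen 0 = D ∧
      HoldsOutcome n (n + c) u ((minimumSubsidyCode c).run σ) ∧
      ∀ S ⊆ Finset.Icc 1 (n + c), S.card = n →
        Dominates n u S ((minimumSubsidyCode c).run σ) := by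
  obtain ⟨hD, hdvd⟩ := run_computeDen hn hm hden
  set D := computeDen.run σ varDen 0 with hDdef
  have fr : ∀ a, a ∉ [2, 3, 18, 19] → (seq computeDen initAvail).run σ a = σ a := fun a ha =>
    run_of_notMem_writes _ _ (by
      simp only [List.mem_cons, not_or] at ha
      simp [writes, computeDen, initAvail, ha])
  have hav := run_initAvail (σ := computeDen.run σ) (m := n + c)
    (by rw [run_of_notMem_writes _ _ (by decide), hm])
  rw [← run_seq] at hav
  set σ₁ := (seq computeDen initAvail).run σ with hσ₁
  have hDσ₁ : σ₁ varDen 0 = D := by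
    rw [hσ₁, run_seq, run_of_notMem_writes _ _ (by decide)]
  have hinst : HoldsInstance n (n + c) (fun i k => D / σ 0 (2 * (i * (n + c) + k) + 2) *
      σ 0 (2 * (i * (n + c) + k) + 1)) σ₁ := by
    refine ⟨by rw [fr _ (by decide), hn], by rw [fr _ (by decide), hm], fun i k => ?_,
      fun i hi k hk => ?_⟩
    · rw [hDσ₁, fr _ (by decide)]
    · obtain ⟨k, rfl⟩ := Nat.exists_eq_add_of_le' (Finset.mem_Icc.1 hk).1
      have hk' : k < n + c := (Finset.mem_Icc.1 hk).2
      exact mul_nonneg (Int.ediv_nonneg hD.le (hden i hi k hk').le) (hnum i hi k hk')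
  obtain ⟨-, h₂, h₃, -⟩ := run_enumerate c hinst hav (by simp)
    (Or.inl (by rw [fr _ (by decide), hsolved]))
  have hrun : (minimumSubsidyCode c).run σ = (enumerate solveAvailable c).run σ₁ := rfl
  refine ⟨D, fun i k => D / σ 0 (2 * (i * (n + c) + k) + 2) *
    σ 0 (2 * (i * (n + c) + k) + 1), hD, fun i hi k hk => ?_, ?_, ?_, ?_⟩
  rotate_left 3
  · rw [hrun]
    exact h₃
  · obtain ⟨q, hq⟩ := hdvd i hi k hk
    have := hden i hi k hk
    simp only
    -- The integer division in the scaled utility is exact, as each denominator divides `D`.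
    rw [hq, Int.mul_ediv_cancel_left _ this.ne']
    ring
  · rw [hrun, run_of_notMem_writes _ _ fun h => ?_, hDσ₁]
    rcases mem_writes_enumerate h with h | h | h
    · exact (solveAvailable_writes_lt h).2.2.1 rfl
    · omega
    · omega
  · rw [hrun]
    -- Domination of any single `n`-element set shows that an outcome was written, which rules out
    -- the first case of `IsSound`.
    have h1 := (h₃ (Finset.Icc 1 n) (Finset.Icc_subset_Icc_right (by omega)) (by simp)).1
    rcases h₂ with h₂ | h₂
    · omega
    · exact h₂.2

end Enumeration

end Algorithm

/-! ### Encoding of the input and the output -/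

section Encoding

/-- Concatenated blocks of equal length `L` are addressed by `i * L + j`. It is used for rows and
for pairs in the input, and for triples in the output. -/
theorem getD_flatMap_of_length_eq {α : Type*} {L : ℕ} (l : List α) (g : α → List ℤ)
    (hg : ∀ x ∈ l, (g x).length = L) {i j : ℕ} (hi : i < l.length) (hj : j < L) :
    (l.flatMap g).getD (i * L + j) 0 = (g l[i]).getD j 0 := by
  induction l generalizing i with
  | nil => simp at hi
  | cons x l ih =>
    have hx : (g x).length = L := hg x (by simp)
    rw [List.flatMap_cons]
    cases i with
    | zero =>
      rw [zero_mul, zero_add, List.getD_append _ _ _ _ (by omega)]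
      rfl
    | succ i =>
      rw [List.getD_append_right _ _ _ _ (by rw [hx, add_mul]; omega), hx,
        show (i + 1) * L + j - L = i * L + j by rw [add_mul]; omega,
        ih (fun y hy => hg y (by simp [hy])) (by simpa using hi)]
      rfl

theorem length_flatMap_of_length_eq {α β : Type*} {L : ℕ} (l : List α) (g : α → List β)
    (hg : ∀ x ∈ l, (g x).length = L) : (l.flatMap g).length = l.length * L := by
  rw [List.length_flatMap, List.map_congr_left hg]
  simp

variable {n m : ℕ}

theorem length_encode_row (I : RatInstance n m) (i : Fin n) :
    ((List.finRange m).flatMap fun h =>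
      [(I.utility i h).num, ((I.utility i h).den : ℤ)]).length = m * 2 := by
  rw [length_flatMap_of_length_eq (L := 2) _ _ (fun _ _ => rfl), List.length_finRange]

theorem length_encode (I : RatInstance n m) : I.encode.length = n * (m * 2) + 2 := by
  rw [RatInstance.encode, List.length_cons, List.length_cons,
    length_flatMap_of_length_eq (L := m * 2) _ _ (fun i _ => length_encode_row I i),
    List.length_finRange]

theorem block_encode (I : RatInstance n m) (i : Fin n) (h : Fin m) {j : ℕ} (hj : j < 2) :
    block I.encode (2 * (i * m + (h + 1)) + 1 + j) =
      [(I.utility i h).num, ((I.utility i h).den : ℤ)].getD j 0 := by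
  have h₁ : 2 * ((i : ℕ) * m + (h + 1)) + 1 + j = (i * (m * 2) + (h * 2 + j)) + 1 + 1 + 1 := by
    ring
  rw [h₁, block, RatInstance.encode, List.getD_cons_succ, List.getD_cons_succ,
    List.getD_cons_succ, getD_flatMap_of_length_eq (L := m * 2) _ _
      (fun i _ => length_encode_row I i) (by simp) (by have := h.2; omega),
    getD_flatMap_of_length_eq (L := 2) _ _ (fun _ _ => rfl) (by simp) hj]
  simp

theorem length_le_inputSize (l : List ℤ) : l.length ≤ inputSize l := by
  rw [inputSize, ← List.length_map (f := bitSize)]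
  refine List.length_le_sum_of_one_le _ fun i hi => ?_
  obtain ⟨z, -, rfl⟩ := List.mem_map.1 hi
  exact one_le_bitSize z

/-- The extra bit is for cell `0`, which holds the length of the input and not one of its entries.
-/
theorem bitSize_initMem_le (l : List ℤ) (a k : ℕ) :
    bitSize (initMem l a k) ≤ inputSize l + 1 := by
  have hlen := length_le_inputSize l
  have hzero : bitSize 0 ≤ inputSize l + 1 := by simp [bitSize]
  unfold initMem
  split
  swap
  · exact hzero
  cases k with
  | zero => exact (bitSize_natCast_le l.length).trans (by omega)
  | succ k =>
    rw [block, List.getD_cons_succ]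
    by_cases hk : k < l.length
    · rw [List.getD_eq_getElem _ _ hk]
      refine le_trans ?_ (Nat.le_succ _)
      exact List.le_sum_of_mem (List.mem_map_of_mem (List.getElem_mem hk))
    · rw [List.getD_eq_default _ _ (by omega)]
      exact hzero

/-- A bound on the cost of a loop program, in terms of the size of the instance. -/
noncomputable def costBound (c : ℕ) (P : Code) : Polynomial ℕ :=
  (P.weight * (Polynomial.X + P.weight * Polynomial.X)).comp
    (Polynomial.X + ((c + 1 : ℕ) : Polynomial ℕ))

/-- The cost of a tame loop program on the encoding of an instance. -/
theorem exec_compile_initMem {c : ℕ} {P : Code} (hP : P.isTame) (I : RatInstance n (n + c)) :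
    ∃ t, Exec P.compile (initMem I.encode) t (P.run (initMem I.encode)) ∧
      t ≤ (costBound c P).eval (inputSize I.encode) := by
  set b := inputSize I.encode + (c + 1) with hb
  have hbits : ∀ a k, bitSize (initMem I.encode a k) ≤ b := fun a k =>
    (bitSize_initMem_le _ a k).trans (by omega)
  have hlen := (length_encode I).symm.le.trans (length_le_inputSize _)
  have hn : n + c ≤ b := by
    -- Without agents there are no utilities, and the length of the input does not bound `m = c`;
    -- this is why `b` includes the summand `c + 1`.
    rcases Nat.eq_zero_or_pos n with rfl | hn
    · omega
    · have : n * 1 ≤ n * ((n + c) * 2) := Nat.mul_le_mul_left n (by omega)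
      omega
  have h₁ : (initMem I.encode 0 1).toNat = n := by simp [initMem, block, RatInstance.encode]
  have h₂ : (initMem I.encode 0 2).toNat = n + c := by
    simp [initMem, block, RatInstance.encode]
    omega
  obtain ⟨t, ht, hle, -⟩ := Code.reachesWithin_compile (M := b) P hP hbits (fun k => hbits 0 k)
    (by omega) (by omega)
  refine ⟨t, ht, hle.trans (le_of_eq ?_)⟩
  simp [costBound, Polynomial.eval_comp, hb]

theorem hasOutput_flatMap {σ : Mem} {a p q : Fin n → ℤ} (h0 : σ 1 0 = 3 * n)
    (h : ∀ i : Fin n, σ 1 (3 * i + 1) = a i ∧ σ 1 (3 * i + 2) = p i ∧ σ 1 (3 * i + 3) = q i) :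
    σ.HasOutput ((List.finRange n).flatMap fun i => [a i, p i, q i]) := by
  have hlen := length_flatMap_of_length_eq (L := 3) (List.finRange n)
    (fun i => [a i, p i, q i]) (fun _ _ => rfl)
  rw [List.length_finRange] at hlen
  intro k hk
  rw [hlen] at hk
  rw [block]
  cases k with
  | zero =>
    rw [h0, List.getD_cons_zero, hlen]
    push_cast
    ring
  | succ k =>
    have hi : k / 3 < n := by omega
    have hk' : k = k / 3 * 3 + k % 3 := by omega
    have hmod : k % 3 < 3 := Nat.mod_lt _ (by omega)
    obtain ⟨e₁, e₂, e₃⟩ := h ⟨k / 3, hi⟩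
    rw [List.getD_cons_succ]
    conv_rhs => rw [hk', getD_flatMap_of_length_eq (L := 3) _ _ (fun _ _ => rfl)
      (by simpa using hi) hmod]
    simp only [List.getElem_finRange, Fin.cast_mk]
    have hcases : k % 3 = 0 ∨ k % 3 = 1 ∨ k % 3 = 2 := by omega
    rcases hcases with hr | hr | hr
    · rw [hr, List.getD_cons_zero, ← e₁]
      congr 1
      simp only
      omega
    · rw [hr, List.getD_cons_succ, List.getD_cons_zero, ← e₂]
      congr 1
      simp only
      omega
    · rw [hr, List.getD_cons_succ, List.getD_cons_succ, List.getD_cons_zero, ← e₃]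
      congr 1
      simp only
      omega

end Encoding

/-! ### From the integer computation to rational outcomes -/

section Correctness

variable {n c : ℕ}

/-- Scaling an envy-free outcome by `D`, with houses numbered from `1`. -/
theorem exists_isSupported {D : ℤ} (hD : 0 < D) {u : ℕ → ℕ → ℤ} {m : ℕ} {v : Fin n → Fin m → ℝ}
    (hu : ∀ (i : Fin n) (h : Fin m), (u i (h + 1) : ℝ) = D * v i h) (o : Outcome n m)
    (ho : o.IsEnvyFree v) :
    ∃ (S : Finset ℕ) (a : ℕ → ℕ) (p : ℕ → ℝ), S ⊆ Finset.Icc 1 m ∧ S.card = n ∧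
      IsSupported n u S a p ∧ ∑ i ∈ Finset.range n, p (a i) = D * ∑ i, o.subsidy i := by
  classical
  set e : Fin n → ℕ := fun i => o.house i + 1 with he
  have hinj : Function.Injective e := fun i j hij => o.house.injective (Fin.ext (by
    simpa [he] using hij))
  set a : ℕ → ℕ := fun i => if h : i < n then e ⟨i, h⟩ else 0 with ha
  -- The subsidy of an agent becomes the price of its house. As `e` is injective, the sum has at
  -- most one nonzero term.
  set p : ℕ → ℝ := fun k => ∑ i : Fin n, if e i = k then D * o.subsidy i else 0 with hp
  have hae : ∀ i : Fin n, a i = e i := fun i => by simp [ha]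
  have hpe : ∀ i : Fin n, p (e i) = D * o.subsidy i := fun i => by
    simp only [hp]
    rw [Finset.sum_eq_single i (fun j _ hj => if_neg (fun h => hj (hinj h))) (by simp), if_pos rfl]
  refine ⟨Finset.univ.image e, a, p, ?_, ?_, ⟨?_, ?_, ?_, ?_⟩, ?_⟩
  · intro k hk
    obtain ⟨i, -, rfl⟩ := Finset.mem_image.1 hk
    have := (o.house i).2
    simp only [he, Finset.mem_Icc]
    omega
  · rw [Finset.card_image_of_injective _ hinj, Finset.card_univ, Fintype.card_fin]
  · intro i hi
    rw [hae ⟨i, hi⟩]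
    exact Finset.mem_image_of_mem _ (Finset.mem_univ _)
  · intro i hi j hj hij
    rw [hae ⟨i, hi⟩, hae ⟨j, hj⟩] at hij
    exact congrArg Fin.val (hinj hij)
  · intro k _
    refine Finset.sum_nonneg fun i _ => ?_
    split
    · exact mul_nonneg (by exact_mod_cast hD.le) (o.subsidy_nonneg i)
    · exact le_rfl
  · intro i hi k hk
    obtain ⟨j, -, rfl⟩ := Finset.mem_image.1 hk
    rw [hae ⟨i, hi⟩, hpe, hpe, hu ⟨i, hi⟩ (o.house j), hu ⟨i, hi⟩ (o.house ⟨i, hi⟩), ← mul_add,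
      ← mul_add]
    exact mul_le_mul_of_nonneg_left (ho ⟨i, hi⟩ j) (by exact_mod_cast hD.le)
  · rw [Finset.sum_range, Finset.mul_sum]
    exact Finset.sum_congr rfl fun i _ => by rw [hae, hpe]

/-- Dividing prices by `D` turns the computed outcome into one for the given utilities. Conversely,
any envy-free outcome, multiplied by `D`, is supported on the set of houses that it uses; that set
was enumerated, hence dominated. -/
theorem exists_isSolution (I : RatInstance n (n + c)) :
    ∃ l, ((minimumSubsidyCode c).run (initMem I.encode)).HasOutput l ∧ I.IsSolution l := by
  set σ := initMem I.encode with hσ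
  have hcell : ∀ (i : Fin n) (h : Fin (n + c)) (j : ℕ), j < 2 →
      σ 0 (2 * (i * (n + c) + (h + 1)) + 1 + j) =
        [(I.utility i h).num, ((I.utility i h).den : ℤ)].getD j 0 := fun i h j hj => by
    rw [hσ, initMem, if_pos rfl, block_encode I i h hj]
  have hnum : ∀ (i : Fin n) (h : Fin (n + c)),
      σ 0 (2 * (i * (n + c) + (h + 1)) + 1) = (I.utility i h).num := fun i h =>
    hcell i h 0 (by omega)
  have hden : ∀ (i : Fin n) (h : Fin (n + c)),
      σ 0 (2 * (i * (n + c) + (h + 1)) + 2) = (I.utility i h).den := fun i h =>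
    hcell i h 1 (by omega)
  obtain ⟨D, u, hD, hu, hDen, ⟨a, s, h0, hout, has, hinj, henvy, hbest⟩, hdom⟩ :=
    run_minimumSubsidyCode (σ := σ) (n := n) (c := c)
      (by simp [hσ, initMem, block, RatInstance.encode])
      (by simp [hσ, initMem, block, RatInstance.encode])
      (by simp [hσ, initMem])
      (fun i hi k hk => by
        rw [hnum ⟨i, hi⟩ ⟨k, hk⟩]
        exact Rat.num_nonneg.2 (I.utility_nonneg _ _))
      (fun i hi k hk => by
        rw [hden ⟨i, hi⟩ ⟨k, hk⟩]
        exact_mod_cast Rat.den_pos _)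
  set τ := (minimumSubsidyCode c).run σ with hτ
  have hDR : (0 : ℝ) < D := by exact_mod_cast hD
  have hscale : ∀ (i : Fin n) (h : Fin (n + c)),
      (u i (h + 1) : ℝ) = D * ((I.utility i h : ℚ) : ℝ) := by
    intro i h
    have h₁ := hu i i.2 h h.2
    rw [hnum, hden] at h₁
    have h₂ : (0 : ℝ) < (I.utility i h).den := by exact_mod_cast Rat.den_pos _
    have h₃ : (u i (h + 1) : ℝ) * (I.utility i h).den = D * (I.utility i h).num := by
      exact_mod_cast h₁
    rw [Rat.cast_def, ← mul_div_assoc, eq_div_iff h₂.ne', h₃]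
  let o : Outcome n (n + c) :=
    { house := ⟨fun i => ⟨a i, (has i i.2).1⟩, fun i j hij =>
        Fin.ext (hinj i i.2 j j.2 (by simpa using hij))⟩
      subsidy := fun i => (s i : ℝ) / D
      subsidy_nonneg := fun i => div_nonneg (by exact_mod_cast (has i i.2).2) hDR.le }
  -- Array `16` is `varBest`, the best total found, in units of `1 / D`.
  have hsum : (D : ℝ) * ∑ i, o.subsidy i = τ 16 0 := by
    rw [hbest, Finset.sum_range, Finset.mul_sum]
    push_cast
    exact Finset.sum_congr rfl fun i _ => mul_div_cancel₀ _ hDR.ne'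
  refine ⟨_, hasOutput_flatMap (a := fun i => ((o.house i : ℕ) : ℤ)) (p := fun i => s i)
    (q := fun _ => D) h0 (fun i => ?_), o, fun i => s i, fun _ => D, ⟨fun i j => ?_, ?_⟩,
    fun i => ⟨hD, rfl⟩, rfl⟩
  · rw [← hDen]
    exact hout i i.2
  · have h₁ := henvy i i.2 j j.2
    have h₂ : (u i (a j + 1) : ℝ) + s j ≤ u i (a i + 1) + s i := by exact_mod_cast h₁
    have h₃ := hscale i (o.house i)
    have h₄ := hscale i (o.house j)
    change (u i (a i + 1) : ℝ) = _ at h₃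
    change (u i (a j + 1) : ℝ) = _ at h₄
    rw [h₃, h₄] at h₂
    have h₅ : ∀ k : Fin n, (D : ℝ) * o.subsidy k = s k := fun k => mul_div_cancel₀ _ hDR.ne'
    rw [← h₅, ← h₅, ← mul_add, ← mul_add] at h₂
    exact le_of_mul_le_mul_left h₂ hDR
  · intro o' ho'
    obtain ⟨S, a', p', hS, hcard, hsup, hp'⟩ := exists_isSupported hD hscale o' ho'
    have := (hdom S hS hcard).2 a' p' hsup
    rw [hp', ← hsum] at this
    exact le_of_mul_le_mul_left this hDR

end Correctness

end HouseAllocation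

theorem theorem2 (c : ℕ) :
    HouseAllocation.SolvableInPolyTime
      (X := Σ n : ℕ, HouseAllocation.RatInstance n (n + c))
      (fun x => x.2.encode) (fun x l => x.2.IsSolution l) := by
  refine ⟨(HouseAllocation.minimumSubsidyCode c).compile,
    HouseAllocation.costBound c (HouseAllocation.minimumSubsidyCode c), fun x => ?_⟩
  obtain ⟨t, ht, hle⟩ := HouseAllocation.exec_compile_initMem
    (HouseAllocation.isTame_minimumSubsidyCode c) x.2
  obtain ⟨l, hl, hsol⟩ := HouseAllocation.exists_isSolution x.2
  exact ⟨t, _, l, ht, hle, hl, hsol⟩
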